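/- Let $k$ be a commutative artinian ring and $n\ge 1$ an integer. Let $(\mathcal C,\mathbb E,\mathfrak s)$ be a $k$-linear $n$-exangulated category in the sense of Herschend–Liu–Nakaoka (with $\mathbb E\colon \mathcal C^{\mathrm{op}}\times\mathcal C\to k\text{-Mod}$ a $k$-bilinear functor) that is Krull–Schmidt and $\mathrm{Ext}$-finite, i.e. every $\mathbb E(Z,A)$ is a finitely generated $k$-module. Assume moreover that, for all composable morphisms $f,g$, if $g\circ f$ is a deflation then so is $g$, and if $g\circ f$ is an inflation then so is $f$. Let $\check k$ be the minimal injective cogenerator of the category of finitely generated $k$-modules and $D=\operatorname{Hom}_k(-,\check k)$. A morphism $f\colon X\to Y$ is $n$-projectively trivial if $\mathbb E(f,A)\colon\mathbb E(Y,A)\to\mathbb E(X,A)$ is zero for every object $A$; the stable category $\underline{\mathcal C}$ is the quotient of $\mathcal C$ by these morphisms. Let $\mathcal C_l$ be the class of the objects $X$ of $\mathcal C$ for which the functor $D\mathbb E(-,X)\colon\underline{\mathcal C}\to k\text{-Mod}$ is representable, i.e. isomorphic to $\underline{\mathcal C}(T,-)$ for some object $T$. A morphism $f\colon X\to Y$ is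 right $C$-determined if every $g\colon L\to Y$ such that $g\circ h$ factors through $f$ for all $h\colon C\to L$ itself factors through $f$. A right minimal version of $f\colon X\to Y$ is a morphism $f'\colon X'\to Y$ such that $f$ and $f'$ factor through each other and every endomorphism $e$ of $X'$ with $f'\circ e=f'$ is invertible. An object $K$ is the intrinsic $n$-kernel of a deflation $\alpha\colon X\to Y$ if there is a distinguished $n$-exangle $$K\xrightarrow{d_0}Z_1\xrightarrow{d_1}\cdots\xrightarrow{d_{n-1}}Z_n\xrightarrow{\alpha'}Y\overset{\delta}{\dashrightarrow}$$ in which $\alpha'$ is a right minimal version of $\alpha$ and $d_0,\dots,d_{n-1}$ lie in the Jacobson radical of $\mathcal C$. An object $I$ is injective if for every distinguished $n$-exangle $A_0\xrightarrow{\alpha_0}A_1\to\cdots\to A_{n+1}\dashrightarrow$ every morphism $A_0\to I$ factors through $\alpha_0$. Let $K$ be an object of $\mathcal C$ without nonzero injective direct summands. Then the following statements are equivalent: (1) $K\in\mathcal C_l$. (2) There is a deflation $\alpha\colon X\to Y$ that is right $C$-determined for some object $C$ and whose intrinsic $n$-kernel is $K$. -/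

import Mathlib

open CategoryTheory CategoryTheory.Limits

universe w v u u'

namespace NExangulated

/-! ### The minimal injective cogenerator and the duality `D` -/

section Duality

/-- `J` is an injective cogenerator for the category of finitely generated `k`-modules: it is an
injective module, and each nonzero element of a finitely generated module is detected by some
linear map to `J`. (Injectivity is a condition on ideals only, by Baer's criterion, so that over a
noetherian ring it can be tested on finitely generated modules.) -/
structure IsInjectiveCogenerator (k : Type u) [CommRing k] (J : Type u) [AddCommGroup J]
    [Module k J] : Prop where
  injective : Module.Injective k J
  cogenerates : ∀ (M : Type u) [AddCommGroup M] [Module k M] [Module.Finite k M] (x : M), x ≠ 0 →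
    ∃ f : M →ₗ[k] J, f x ≠ 0

/-- `J` is a minimal injective cogenerator: no proper submodule is an injective cogenerator. -/
structure IsMinimalInjectiveCogenerator (k : Type u) [CommRing k] (J : Type u) [AddCommGroup J]
    [Module k J] : Prop extends IsInjectiveCogenerator k J where
  minimal : ∀ N : Submodule k J, IsInjectiveCogenerator k N → N = ⊤

theorem exists_isMinimalInjectiveCogenerator (k : Type u) [CommRing k] :
    ∃ (J : Type u) (_ : AddCommGroup J) (_ : Module k J), IsMinimalInjectiveCogenerator k J := by
  classical
  let P : Type u := ∀ m : MaximalSpectrum k, k ⧸ m.asIdeal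
  obtain ⟨⟨I₀, hI₀, j₀, hj₀⟩⟩ := EnoughInjectives.presentation (ModuleCat.of k P)
  have hI : Module.Injective k I₀ := Module.injective_module_of_injective_object k I₀
  have hj : Function.Injective j₀.hom := (ModuleCat.mono_iff_injective _).1 hj₀
  generalize j₀.hom = j at hj
  clear hj₀ j₀ hI₀
  let I : Type u := I₀
  change P →ₗ[k] I at j
  let S : Submodule k I := ⨆ m, LinearMap.range (j ∘ₗ LinearMap.single k _ m)
  have hSj : S ≤ LinearMap.range j := iSup_le fun m => LinearMap.range_comp_le_range _ _
  let Ess : Set (Submodule k I) := {E | S ≤ E ∧ ∀ x ∈ E, x ≠ 0 → ∃ a : k, a • x ∈ S ∧ a • x ≠ 0}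
  have hSE : S ∈ Ess := ⟨le_rfl, fun x hx h0 => ⟨1, by simpa using hx, by simpa using h0⟩⟩
  obtain ⟨E, hES, hEmax⟩ := zorn_le_nonempty₀ Ess (by
    intro c hc hch E hE
    refine ⟨sSup c, ⟨(hc hE).1.trans (le_sSup hE), ?_⟩, fun z hz => le_sSup hz⟩
    intro x hx
    obtain ⟨F, hF, hxF⟩ := (Submodule.mem_sSup_of_directed ⟨E, hE⟩ hch.directedOn).1 hx
    exact (hc hF).2 x hxF) S hSE
  obtain ⟨C, -, hCmax⟩ := zorn_le_nonempty₀ {C : Submodule k I | ∀ x ∈ C, x ∈ E → x = 0} (by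
    intro c hc hch E hE
    refine ⟨sSup c, ?_, fun z hz => le_sSup hz⟩
    intro x hx
    obtain ⟨F, hF, hxF⟩ := (Submodule.mem_sSup_of_directed ⟨E, hE⟩ hch.directedOn).1 hx
    exact hc hF x hxF) ⊥ (by intro x hx _; simpa using hx)
  have key : ∀ x ∉ C, ∃ a : k, ∃ c ∈ C, c + a • x ∈ E ∧ c + a • x ≠ 0 := by
    intro x hx
    by_contra! H
    have hle := hCmax.2 (y := C ⊔ Submodule.span k {x}) (by
      intro y hy hyE
      obtain ⟨c, hc, z, hz, rfl⟩ := Submodule.mem_sup.1 hy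
      obtain ⟨a, rfl⟩ := Submodule.mem_span_singleton.1 hz
      exact H a c hc hyE) le_sup_left
    exact hx (hle (Submodule.mem_sup_right (Submodule.mem_span_singleton_self x)))
  obtain ⟨g, hg⟩ := Module.Injective.extension_property k I E (I ⧸ C) (C.mkQ ∘ₗ E.subtype) (by
    rw [← LinearMap.ker_eq_bot, LinearMap.ker_eq_bot']
    rintro ⟨e, he⟩ h0
    have : e ∈ C := by simpa using h0
    exact Subtype.ext (hCmax.1 e this he)) E.subtype
  have hgE : ∀ e (_ : e ∈ E), g (C.mkQ e) = e := fun e he => LinearMap.congr_fun hg ⟨e, he⟩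
  have hga : ∀ x (a : k), ∀ c ∈ C, c + a • x ∈ E → a • g (C.mkQ x) = c + a • x := by
    intro x a c hc h
    have h1 := hgE _ h
    have h2 : C.mkQ c = 0 := by simpa using hc
    rwa [map_add, h2, zero_add, map_smul, map_smul] at h1
  have hE2 := hEmax.1.2
  have hrange : LinearMap.range g ≤ E := by
    refine hEmax.2 (y := LinearMap.range g) ⟨?_, ?_⟩ ?_
    · exact fun e he => ⟨_, hgE e (hES he)⟩
    · rintro _ ⟨y, rfl⟩ h0
      obtain ⟨x, rfl⟩ := C.mkQ_surjective y
      have hx : x ∉ C := by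
        intro hx
        apply h0
        rw [show C.mkQ x = 0 by simpa using hx, map_zero]
      obtain ⟨a, c, hc, hE', hne⟩ := key x hx
      obtain ⟨b, hb, hb0⟩ := hE2 _ hE' hne
      rw [← hga x a c hc hE', smul_smul] at hb hb0
      exact ⟨b * a, hb, hb0⟩
    · exact fun e he => ⟨_, hgE e he⟩
  let r : I →ₗ[k] E := LinearMap.codRestrict E (g ∘ₗ C.mkQ) fun x => hrange ⟨_, rfl⟩
  have hr : ∀ e : E, r e = e := fun e => Subtype.ext (hgE e e.2)
  have hEinj : Module.Injective k E := ⟨fun X Y _ _ _ _ f hf h => by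
    obtain ⟨h', hh'⟩ := Module.Injective.out f hf (E.subtype ∘ₗ h)
    exact ⟨r ∘ₗ h', fun x => by simp [hh', hr]⟩⟩
  have hjS : ∀ m x, j (LinearMap.single k _ m x) ∈ E := fun m x =>
    hES (Submodule.mem_iSup_of_mem m ⟨x, rfl⟩)
  refine ⟨E, inferInstance, inferInstance, ⟨hEinj, ?_⟩, ?_⟩
  · intro M _ _ _ x hx
    have hne : Ideal.torsionOf k M x ≠ ⊤ := by simpa using hx
    obtain ⟨m, hm, hle⟩ := Ideal.exists_le_maximal _ hne
    let m' : MaximalSpectrum k := ⟨m, hm⟩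
    let φ : (k ∙ x) →ₗ[k] E := LinearMap.codRestrict E
      (j ∘ₗ LinearMap.single k _ m' ∘ₗ Submodule.factor hle ∘ₗ
        (Ideal.quotTorsionOfEquivSpanSingleton k M x).symm.toLinearMap) (fun y => hjS _ _)
    obtain ⟨f, hf⟩ := Module.Injective.extension_property k E (k ∙ x) M (k ∙ x).subtype
      Subtype.val_injective φ
    refine ⟨f, fun h0 => ?_⟩
    have h1 : φ ⟨x, Submodule.mem_span_singleton_self x⟩ = 0 := by
      rw [← hf]; exact h0
    have h2 : (Ideal.quotTorsionOfEquivSpanSingleton k M x).symm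
        ⟨x, Submodule.mem_span_singleton_self x⟩ = Submodule.Quotient.mk 1 := by
      rw [LinearEquiv.symm_apply_eq]
      rw [Ideal.quotTorsionOfEquivSpanSingleton_apply_mk, one_smul]
    have h3 : j (LinearMap.single k _ m' (Submodule.factor hle (Submodule.Quotient.mk 1))) = 0 := by
      rw [← h2]; exact congrArg Subtype.val h1
    rw [← map_zero j] at h3
    have h4 := congrFun (hj h3) m'
    have h5 : (Ideal.Quotient.mk m 1 : k ⧸ m) = 0 := by
      simp only [LinearMap.single_apply, m', Pi.single_eq_same] at h4
      exact h4
    exact hm.ne_top ((Ideal.eq_top_iff_one m).2 (Ideal.Quotient.eq_zero_iff_mem.1 h5))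
  · intro N hN
    have hSN : ∀ s ∈ S, ∃ h : s ∈ E, (⟨s, h⟩ : E) ∈ N := by
      suffices S ≤ N.map E.subtype by
        intro s hs
        obtain ⟨⟨y, hy⟩, hyN, rfl⟩ := this hs
        exact ⟨hy, hyN⟩
      refine iSup_le fun m => ?_
      have hmm := m.isMaximal
      have h1 : (1 : k ⧸ m.asIdeal) ≠ 0 := by
        intro h
        exact hmm.ne_top ((Ideal.eq_top_iff_one _).2 (Ideal.Quotient.eq_zero_iff_mem.1 h))
      obtain ⟨f, hf⟩ := hN.cogenerates (k ⧸ m.asIdeal) 1 h1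
      obtain ⟨t, ht⟩ : ∃ t : I, t = (((f 1 : N) : E) : I) := ⟨_, rfl⟩
      have ht0 : t ≠ 0 := by
        intro h; exact hf (Subtype.ext (Subtype.ext (ht ▸ h)))
      obtain ⟨b, hbS, hb0⟩ := hE2 t (ht ▸ (f 1 : N).1.2) ht0
      obtain ⟨p, hp⟩ := hSj hbS
      have hmt : ∀ a ∈ m.asIdeal, a • t = 0 := by
        intro a ha
        have : a • f 1 = 0 := by
          rw [← map_smul, ← map_zero f]
          congr 1
          have h := Ideal.Quotient.eq_zero_iff_mem.2
            (show a • (1 : k) ∈ m.asIdeal by simpa using ha)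
          exact h
        rw [ht]
        exact congrArg (fun z : N => ((z : E) : I)) this
      have hmp : ∀ a ∈ m.asIdeal, a • p = 0 := by
        intro a ha
        apply hj
        rw [map_smul, hp, smul_comm, hmt a ha, smul_zero, map_zero]
      have hps : p = LinearMap.single k _ m (p m) := by
        ext m'
        by_cases h : m' = m
        · subst h; simp
        · have hne : m.asIdeal ⊔ m'.asIdeal = ⊤ :=
            hmm.coprime_of_ne m'.isMaximal fun h' => h (MaximalSpectrum.ext h'.symm)
          obtain ⟨a, ha, b', hb', hab⟩ := Submodule.mem_sup.1 (hne ▸ Submodule.mem_top : (1 : k) ∈ _)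
          have h2 : p m' = a • p m' + b' • p m' := by rw [← add_smul, hab, one_smul]
          have h3 : a • p m' = 0 := congrFun (hmp a ha) m'
          have h4 : b' • p m' = 0 := by
            obtain ⟨z, hz⟩ := Ideal.Quotient.mk_surjective (p m')
            rw [← hz, ← Ideal.Quotient.mk_eq_mk, ← Submodule.Quotient.mk_smul]
            exact Ideal.Quotient.eq_zero_iff_mem.2 (m'.asIdeal.mul_mem_right _ hb')
          rw [h2, h3, h4, LinearMap.single_apply, Pi.single_eq_of_ne h, add_zero]
      have hpm : p m ≠ 0 := by
        intro h
        rw [h, map_zero] at hps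
        rw [hps, map_zero] at hp
        exact hb0 hp.symm
      rintro _ ⟨y, rfl⟩
      let _ := Ideal.Quotient.field m.asIdeal
      obtain ⟨c, hc⟩ := Ideal.Quotient.mk_surjective (y / p m)
      have hy : y = c • p m := by
        have : y = Ideal.Quotient.mk m.asIdeal c * p m := by rw [hc, div_mul_cancel₀ _ hpm]
        rw [this]
        rfl
      have : (j ∘ₗ LinearMap.single k _ m) y = c • b • t := by
        rw [hy, map_smul, LinearMap.comp_apply, ← hps, hp]
      rw [this]
      exact Submodule.smul_mem _ _ (Submodule.smul_mem _ _ ⟨_, (f 1 : N).2, ht.symm⟩)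
    obtain ⟨ρ, hρ⟩ := hN.injective.out N.subtype Subtype.val_injective LinearMap.id
    rw [eq_top_iff]
    rintro x -
    by_contra hx
    set y : E := x - (ρ x : N) with hy
    have hy0 : (y : I) ≠ 0 := by
      intro h
      apply hx
      have : y = 0 := Subtype.ext h
      have h' : x = (ρ x : N) := sub_eq_zero.1 (hy.symm.trans this)
      exact h' ▸ (ρ x).2
    have hρy : ρ y = 0 := by
      rw [hy, map_sub, sub_eq_zero]
      exact (hρ (ρ x)).symm
    obtain ⟨a, haS, ha0⟩ := hE2 _ y.2 hy0
    obtain ⟨h, hN'⟩ := hSN _ haS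
    have h1 := hρ ⟨_, hN'⟩
    have h2 : ρ (a • y) = 0 := by rw [map_smul, hρy, smul_zero]
    apply ha0
    have h3 : (⟨a • (y : I), h⟩ : E) = a • y := rfl
    have h4 := congrArg (fun z : N => ((z : E) : I)) (h1.symm.trans h2)
    exact h4

/-- The minimal injective cogenerator of `k` (unique up to isomorphism). -/
noncomputable def kCheck (k : Type u) [CommRing k] : Type u :=
  (exists_isMinimalInjectiveCogenerator k).choose

noncomputable instance (k : Type u) [CommRing k] : AddCommGroup (kCheck k) :=
  (exists_isMinimalInjectiveCogenerator k).choose_spec.choose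

noncomputable instance (k : Type u) [CommRing k] : Module k (kCheck k) :=
  (exists_isMinimalInjectiveCogenerator k).choose_spec.choose_spec.choose

theorem isMinimalInjectiveCogenerator_kCheck (k : Type u) [CommRing k] :
    IsMinimalInjectiveCogenerator k (kCheck k) :=
  (exists_isMinimalInjectiveCogenerator k).choose_spec.choose_spec.choose_spec

/-- The dual `D M = Hom_k(M, ǩ)`, where `ǩ` is the minimal injective cogenerator. -/
abbrev D (k : Type u) [CommRing k] (M : Type w) [AddCommGroup M] [Module k M] : Type (max u w) :=
  M →ₗ[k] kCheck k

end Duality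

/-! ### Notions in an arbitrary (pre)additive category -/

section Category

variable {C : Type u} [Category.{v} C]

/-- `C` is Krull-Schmidt: each object is a finite direct sum of objects with local endomorphism
rings. -/
def IsKrullSchmidt (C : Type u) [Category.{v} C] [Preadditive C] [HasFiniteBiproducts C] : Prop :=
  ∀ X : C, ∃ (m : ℕ) (Y : Fin m → C),
    (∀ i, IsLocalRing (End (Y i))) ∧ Nonempty (X ≅ ⨁ Y)

/-- `f` lies in the Jacobson radical of the category `C`: `𝟙 - g ∘ f` is invertible for all `g`. -/
def IsRadical [Preadditive C] {X Y : C} (f : X ⟶ Y) : Prop :=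
  ∀ g : Y ⟶ X, IsIso (𝟙 X - f ≫ g)

/-- `g` factors through `f`. -/
def FactorsThrough {X L Y : C} (g : L ⟶ Y) (f : X ⟶ Y) : Prop :=
  ∃ s : L ⟶ X, s ≫ f = g

/-- `f` is right `T`-determined: `g` factors through `f` as soon as `g ∘ h` factors through `f` for
each morphism `h` from `T` to the source of `g`. -/
def IsRightDetermined {X Y : C} (f : X ⟶ Y) (T : C) : Prop :=
  ∀ (L : C) (g : L ⟶ Y), (∀ h : T ⟶ L, FactorsThrough (h ≫ g) f) → FactorsThrough g f

/-- `f` is right minimal: each endomorphism `e` of its source with `f ∘ e = f` is invertible. -/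
def IsRightMinimal {X Y : C} (f : X ⟶ Y) : Prop :=
  ∀ e : X ⟶ X, e ≫ f = f → IsIso e

/-- Two morphisms with the same target are right equivalent if each factors through the other. -/
def RightEquivalent {X X' Y : C} (f : X ⟶ Y) (f' : X' ⟶ Y) : Prop :=
  FactorsThrough f f' ∧ FactorsThrough f' f

/-- `f'` is a right minimal version of `f`. -/
def IsRightMinimalVersion {X X' Y : C} (f' : X' ⟶ Y) (f : X ⟶ Y) : Prop :=
  IsRightMinimal f' ∧ RightEquivalent f' f

end Category

/-! ### Extensions -/

section Extensions

variable {k : Type u'} [CommRing k] {C : Type u} [Category.{v} C]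

/-- The module `𝔼(Z, A)` of extensions. -/
abbrev ExtMod (E : Cᵒᵖ ⥤ C ⥤ ModuleCat.{w} k) (Z A : C) : Type w :=
  (E.obj (Opposite.op Z)).obj A

variable (E : Cᵒᵖ ⥤ C ⥤ ModuleCat.{w} k)

/-- `a_* = 𝔼(Z, a)`. -/
def push {A A' : C} (Z : C) (a : A ⟶ A') : ExtMod E Z A →ₗ[k] ExtMod E Z A' :=
  ((E.obj (Opposite.op Z)).map a).hom

/-- `c^* = 𝔼(c, A)`. -/
def pull {Z Z' : C} (A : C) (c : Z' ⟶ Z) : ExtMod E Z A →ₗ[k] ExtMod E Z' A :=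
  ((E.map c.op).app A).hom

/-- The functor `𝔼 : Cᵒᵖ × C → k-Mod` is `k`-bilinear on morphisms. -/
structure IsBilinear [Preadditive C] [Linear k C] : Prop where
  push_add : ∀ {A A' : C} (Z : C) (a b : A ⟶ A'), push E Z (a + b) = push E Z a + push E Z b
  push_smul : ∀ {A A' : C} (Z : C) (r : k) (a : A ⟶ A'), push E Z (r • a) = r • push E Z a
  pull_add : ∀ {Z Z' : C} (A : C) (c d : Z' ⟶ Z), pull E A (c + d) = pull E A c + pull E A d
  pull_smul : ∀ {Z Z' : C} (A : C) (r : k) (c : Z' ⟶ Z), pull E A (r • c) = r • pull E A c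

/-- The category is Ext-finite. -/
def IsExtFinite : Prop :=
  ∀ Z A : C, Module.Finite k (ExtMod E Z A)

end Extensions

/-! ### Complexes of length `n + 2` with given end terms -/

section Complexes

variable {C : Type u} [Category.{v} C] [Preadditive C] {n : ℕ}

/-- A complex `X₀ ⟶ X₁ ⟶ ⋯ ⟶ Xₙ ⟶ Xₙ₊₁`, that is, a complex whose components are zero in the degrees
outside of `{0, …, n + 1}`, with end terms `X₀` and `Xₙ₊₁` identified with `A` and `Z`. -/
structure NComplex (n : ℕ) (A Z : C) where
  cx : CochainComplex C ℕ
  isZero : ∀ i, n + 1 < i → IsZero (cx.X i)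
  left : cx.X 0 ≅ A
  right : cx.X (n + 1) ≅ Z

namespace NComplex

variable {A A' A'' Z Z' Z'' : C}

/-- The first differential, as a morphism `A ⟶ X₁`. -/
def dFirst (X : NComplex n A Z) : A ⟶ X.cx.X 1 :=
  X.left.inv ≫ X.cx.d 0 1

/-- The last differential, as a morphism `Xₙ ⟶ Z`. -/
def dLast (X : NComplex n A Z) : X.cx.X n ⟶ Z :=
  X.cx.d n (n + 1) ≫ X.right.hom

/-- The morphism of complexes `f` is of the form `(a, f₁, …, fₙ, c)`. -/
def IsLift {X : NComplex n A Z} {Y : NComplex n A' Z'} (f : X.cx ⟶ Y.cx)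
    (a : A ⟶ A') (c : Z ⟶ Z') : Prop :=
  f.f 0 ≫ Y.left.hom = X.left.hom ≫ a ∧ f.f (n + 1) ≫ Y.right.hom = X.right.hom ≫ c

theorem IsLift.id (X : NComplex n A Z) : IsLift (X := X) (Y := X) (𝟙 X.cx) (𝟙 A) (𝟙 Z) := by
  simp [IsLift]

theorem IsLift.comp {X : NComplex n A Z} {Y : NComplex n A' Z'} {W : NComplex n A'' Z''}
    {f : X.cx ⟶ Y.cx} {g : Y.cx ⟶ W.cx} {a : A ⟶ A'} {a' : A' ⟶ A''} {c : Z ⟶ Z'} {c' : Z' ⟶ Z''}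
    (hf : IsLift f a c) (hg : IsLift g a' c') :
    IsLift (X := X) (Y := W) (f ≫ g) (a ≫ a') (c ≫ c') := by
  constructor
  · rw [HomologicalComplex.comp_f, Category.assoc, hg.1, ← Category.assoc, hf.1, Category.assoc]
  · rw [HomologicalComplex.comp_f, Category.assoc, hg.2, ← Category.assoc, hf.2, Category.assoc]

/-- `X` and `Y` are homotopy equivalent, by morphisms that are the identity on the end terms `A`
and `Z`. -/
def HomotopyEquivalent (X Y : NComplex n A Z) : Prop :=
  ∃ (f : X.cx ⟶ Y.cx) (g : Y.cx ⟶ X.cx), IsLift f (𝟙 A) (𝟙 Z) ∧ IsLift g (𝟙 A) (𝟙 Z) ∧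
    Nonempty (Homotopy (f ≫ g) (𝟙 X.cx)) ∧ Nonempty (Homotopy (g ≫ f) (𝟙 Y.cx))

/-- Homotopy equivalence of complexes with end terms `A` and `Z`. -/
instance homotopySetoid (n : ℕ) (A Z : C) : Setoid (NComplex n A Z) where
  r := HomotopyEquivalent
  iseqv :=
    { refl := fun X => ⟨𝟙 _, 𝟙 _, IsLift.id X, IsLift.id X,
        ⟨Homotopy.ofEq (Category.comp_id _)⟩, ⟨Homotopy.ofEq (Category.comp_id _)⟩⟩
      symm := fun ⟨f, g, hf, hg, h, h'⟩ => ⟨g, f, hg, hf, h', h⟩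
      trans := by
        rintro X Y W ⟨f, g, hf, hg, ⟨h⟩, ⟨h'⟩⟩ ⟨p, q, hp, hq, ⟨l⟩, ⟨l'⟩⟩
        refine ⟨f ≫ p, q ≫ g, by simpa using hf.comp hp, by simpa using hq.comp hg, ⟨?_⟩, ⟨?_⟩⟩
        · exact (Homotopy.ofEq (by simp)).trans
            (((l.compLeft f).compRight g).trans ((Homotopy.ofEq (by simp)).trans h))
        · exact (Homotopy.ofEq (by simp)).trans
            (((h'.compLeft q).compRight p).trans ((Homotopy.ofEq (by simp)).trans l')) }

/-- For a morphism of complexes `f : X ⟶ Y` that is the identity on the left end term, `M` is the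
mapping cone `X₁ ⟶ X₂ ⊕ Y₁ ⟶ ⋯ ⟶ Xₙ₊₁ ⊕ Yₙ ⟶ Yₙ₊₁`, with the differentials
`(-d, f)`, `((-d, 0), (f, d))` and `(f, d)`. The morphisms `p i` and `q i` are the projections of
`Mᵢ` to `Xᵢ₊₁` and `Yᵢ`; `q 0` plays no role. -/
def IsMappingCone {X : NComplex n A Z} {Y : NComplex n A Z'} (f : X.cx ⟶ Y.cx)
    (M : NComplex n (X.cx.X 1) Z') : Prop :=
  ∃ (p : ∀ i, M.cx.X i ⟶ X.cx.X (i + 1)) (q : ∀ i, M.cx.X i ⟶ Y.cx.X i),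
    p 0 = M.left.hom ∧ q (n + 1) ≫ Y.right.hom = M.right.hom ∧
    (∀ i, 1 ≤ i → i ≤ n → Nonempty (IsLimit (BinaryFan.mk (p i) (q i)))) ∧
    M.cx.d 0 1 ≫ p 1 = -(p 0 ≫ X.cx.d 1 2) ∧
    M.cx.d 0 1 ≫ q 1 = p 0 ≫ f.f 1 ∧
    ∀ i, 1 ≤ i → i ≤ n →
      M.cx.d i (i + 1) ≫ p (i + 1) = -(p i ≫ X.cx.d (i + 1) (i + 2)) ∧
      M.cx.d i (i + 1) ≫ q (i + 1) = p i ≫ f.f (i + 1) + q i ≫ Y.cx.d i (i + 1)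

/-- For a morphism of complexes `f : X ⟶ Y` that is the identity on the right end term, `N` is the
mapping cocone `X₀ ⟶ X₁ ⊕ Y₀ ⟶ ⋯ ⟶ Xₙ ⊕ Yₙ₋₁ ⟶ Yₙ`, with the differentials
`(d, f)`, `((d, 0), (f, -d))` and `(f, -d)`. The morphisms `p i` and `q i` are the projections of
`Nᵢ` to `Xᵢ` and of `Nᵢ₊₁` to `Yᵢ`; `p (n + 1)` plays no role. -/
def IsMappingCocone {X : NComplex n A Z} {Y : NComplex n A' Z} (f : X.cx ⟶ Y.cx)
    (N : NComplex n A (Y.cx.X n)) : Prop :=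
  ∃ (p : ∀ i, N.cx.X i ⟶ X.cx.X i) (q : ∀ i, N.cx.X (i + 1) ⟶ Y.cx.X i),
    p 0 ≫ X.left.hom = N.left.hom ∧ q n = N.right.hom ∧
    (∀ i, i + 1 ≤ n → Nonempty (IsLimit (BinaryFan.mk (p (i + 1)) (q i)))) ∧
    (∀ i, i + 1 ≤ n → N.cx.d i (i + 1) ≫ p (i + 1) = p i ≫ X.cx.d i (i + 1)) ∧
    N.cx.d 0 1 ≫ q 0 = p 0 ≫ f.f 0 ∧
    ∀ i, i + 1 ≤ n →
      N.cx.d (i + 1) (i + 2) ≫ q (i + 1) =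
        p (i + 1) ≫ f.f (i + 1) - q i ≫ Y.cx.d i (i + 1)

end NComplex

end Complexes

/-! ### `n`-exangulated categories -/

section NExangulated

open NComplex

variable {k : Type u'} [CommRing k] {C : Type u} [Category.{v} C] [Preadditive C] {n : ℕ}
variable (E : Cᵒᵖ ⥤ C ⥤ ModuleCat.{w} k)

/-- `⟨X, δ⟩` is an `n`-exangle: `(d₀)_* δ = 0` and `(dₙ)^* δ = 0`, and for each object `W` the sequences
`C(W, X₀) ⟶ ⋯ ⟶ C(W, Xₙ₊₁) ⟶ 𝔼(W, X₀)` and `C(Xₙ₊₁, W) ⟶ ⋯ ⟶ C(X₀, W) ⟶ 𝔼(Xₙ₊₁, W)`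
are exact. -/
structure IsNExangle {A Z : C} (X : NComplex n A Z) (δ : ExtMod E Z A) : Prop where
  push_dFirst : push E Z X.dFirst δ = 0
  pull_dLast : pull E A X.dLast δ = 0
  exact_contra : ∀ (W : C) (i : ℕ), i < n → ∀ g : W ⟶ X.cx.X (i + 1),
    g ≫ X.cx.d (i + 1) (i + 2) = 0 → ∃ h : W ⟶ X.cx.X i, h ≫ X.cx.d i (i + 1) = g
  exact_contra_last : ∀ (W : C) (g : W ⟶ Z), pull E A g δ = 0 →
    ∃ h : W ⟶ X.cx.X n, h ≫ X.dLast = g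
  exact_co : ∀ (W : C) (i : ℕ), i < n → ∀ g : X.cx.X (i + 1) ⟶ W,
    X.cx.d i (i + 1) ≫ g = 0 → ∃ h : X.cx.X (i + 2) ⟶ W, X.cx.d (i + 1) (i + 2) ≫ h = g
  exact_co_first : ∀ (W : C) (g : A ⟶ W), push E Z g δ = 0 →
    ∃ h : X.cx.X 1 ⟶ W, X.dFirst ≫ h = g

/-- A correspondence that associates a homotopy equivalence class of complexes
`A ⟶ X₁ ⟶ ⋯ ⟶ Xₙ ⟶ Z` to each extension `δ ∈ 𝔼(Z, A)`. -/
abbrev Correspondence (n : ℕ) : Type (max u v w) :=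
  ∀ ⦃A Z : C⦄, ExtMod E Z A → Quotient (homotopySetoid n A Z)

variable {E}
variable (s : Correspondence E n)

/-- `X` realizes `δ`; for an exact realization, `⟨X, δ⟩` is a distinguished `n`-exangle. -/
def Realizes {A Z : C} (X : NComplex n A Z) (δ : ExtMod E Z A) : Prop :=
  s δ = Quotient.mk _ X

/-- `s` is an exact realization of `𝔼`. -/
structure IsExactRealization : Prop where
  /-- each morphism of extensions `(a, c) : δ ⟶ ρ` has a lift -/
  lift : ∀ {A Z A' Z' : C} (δ : ExtMod E Z A) (ρ : ExtMod E Z' A') (X : NComplex n A Z)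
    (Y : NComplex n A' Z'), Realizes s X δ → Realizes s Y ρ →
    ∀ (a : A ⟶ A') (c : Z ⟶ Z'), push E Z a δ = pull E A' c ρ →
      ∃ f : X.cx ⟶ Y.cx, IsLift f a c
  /-- the realizations are `n`-exangles -/
  isNExangle : ∀ {A Z : C} (δ : ExtMod E Z A) (X : NComplex n A Z), Realizes s X δ →
    IsNExangle E X δ
  /-- `0 ∈ 𝔼(0, A)` is realized by `A = A ⟶ 0 ⟶ ⋯ ⟶ 0` -/
  zero_right : ∀ {A Z : C} (X : NComplex n A Z), IsIso (X.cx.d 0 1) →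
    (∀ i, 2 ≤ i → IsZero (X.cx.X i)) → Realizes s X 0
  /-- `0 ∈ 𝔼(A, 0)` is realized by `0 ⟶ ⋯ ⟶ 0 ⟶ A = A` -/
  zero_left : ∀ {A Z : C} (X : NComplex n A Z), IsIso (X.cx.d n (n + 1)) →
    (∀ i, i < n → IsZero (X.cx.X i)) → Realizes s X 0

/-- `f` is an inflation: up to an identification of its target with `X₁`, it is the first
differential of a conflation. -/
def IsInflation {A B : C} (f : A ⟶ B) : Prop :=
  ∃ (Z : C) (δ : ExtMod E Z A) (X : NComplex n A Z) (e : X.cx.X 1 ≅ B),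
    Realizes s X δ ∧ X.dFirst ≫ e.hom = f

/-- `g` is a deflation: up to an identification of its source with `Xₙ`, it is the last differential
of a conflation. -/
def IsDeflation {B Z : C} (g : B ⟶ Z) : Prop :=
  ∃ (A : C) (δ : ExtMod E Z A) (X : NComplex n A Z) (e : B ≅ X.cx.X n),
    Realizes s X δ ∧ e.hom ≫ X.dLast = g

/-- `s` is an exact realization of `𝔼` that satisfies the axioms (EA1), (EA2) and (EA2ᵒᵖ) of an
`n`-exangulated category. -/
structure IsNExangulated : Prop extends IsExactRealization s where
  inflation_comp : ∀ {X Y Z : C} (f : X ⟶ Y) (g : Y ⟶ Z),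
    IsInflation s f → IsInflation s g → IsInflation s (f ≫ g)
  deflation_comp : ∀ {X Y Z : C} (f : X ⟶ Y) (g : Y ⟶ Z),
    IsDeflation s f → IsDeflation s g → IsDeflation s (f ≫ g)
  /-- `(𝟙, c)` has a good lift -/
  good_lift : ∀ {A Z Z' : C} (ρ : ExtMod E Z' A) (c : Z ⟶ Z') (X : NComplex n A Z)
    (Y : NComplex n A Z'), Realizes s X (pull E A c ρ) → Realizes s Y ρ →
    ∃ f : X.cx ⟶ Y.cx, IsLift f (𝟙 A) c ∧ ∃ M : NComplex n (X.cx.X 1) Z',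
      IsMappingCone f M ∧ Realizes s M (push E Z' X.dFirst ρ)
  /-- `(a, 𝟙)` has a good lift -/
  good_colift : ∀ {A A' Z : C} (ρ : ExtMod E Z A) (a : A ⟶ A') (X : NComplex n A Z)
    (Y : NComplex n A' Z), Realizes s X ρ → Realizes s Y (push E Z a ρ) →
    ∃ f : X.cx ⟶ Y.cx, IsLift f a (𝟙 Z) ∧ ∃ N : NComplex n A (Y.cx.X n),
      IsMappingCocone f N ∧ Realizes s N (pull E A Y.dLast ρ)

/-- The analogue of the condition (WIC): if `g ∘ f` is a deflation, then so is `g`, and if `g ∘ f`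
is an inflation, then so is `f`. -/
structure SatisfiesWIC : Prop where
  deflation_of_comp : ∀ {X Y Z : C} (f : X ⟶ Y) (g : Y ⟶ Z),
    IsDeflation s (f ≫ g) → IsDeflation s g
  inflation_of_comp : ∀ {X Y Z : C} (f : X ⟶ Y) (g : Y ⟶ Z),
    IsInflation s (f ≫ g) → IsInflation s f

/-- `I` is injective: each morphism to `I` from the left end term of a distinguished `n`-exangle
extends along the first differential. -/
def IsInjectiveObject (I : C) : Prop :=
  ∀ {A Z : C} (δ : ExtMod E Z A) (X : NComplex n A Z), Realizes s X δ →
    ∀ g : A ⟶ I, ∃ h : X.cx.X 1 ⟶ I, X.dFirst ≫ h = g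

/-- `K` has no nonzero injective direct summands. -/
def HasNoInjectiveSummands [HasFiniteBiproducts C] (K : C) : Prop :=
  have := HasBinaryBiproducts.of_hasBinaryProducts (C := C)
  ∀ I J : C, Nonempty (K ≅ I ⊞ J) → IsInjectiveObject s I → IsZero I

/-- `K` is the intrinsic `n`-kernel of `α`: there is a distinguished `n`-exangle
`K ⟶ X₁ ⟶ ⋯ ⟶ Xₙ ⟶ Z` whose last differential is a right minimal version of `α` and whose other
differentials all lie in the Jacobson radical of `C`. -/
def IsIntrinsicNKernel {B Z : C} (α : B ⟶ Z) (K : C) : Prop :=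
  ∃ (δ : ExtMod E Z K) (X : NComplex n K Z), Realizes s X δ ∧ IsRightMinimalVersion X.dLast α ∧
    ∀ i, i < n → IsRadical (X.cx.d i (i + 1))

end NExangulated

/-! ### The stable category and the subcategory `C_l` -/

section Stable

variable {k : Type u'} [CommRing k] {C : Type u} [Category.{v} C] [Preadditive C] [Linear k C]
variable (E : Cᵒᵖ ⥤ C ⥤ ModuleCat.{w} k)

/-- `f : X ⟶ Y` is `n`-projectively trivial: `𝔼(f, A) : 𝔼(Y, A) ⟶ 𝔼(X, A)` is zero for each `A`. -/
def IsProjectivelyTrivial {X Y : C} (f : X ⟶ Y) : Prop :=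
  ∀ A : C, pull E A f = 0

variable {E} in
/-- The submodule of the `n`-projectively trivial morphisms from `X` to `Y`. -/
def projTrivial (hE : IsBilinear E) (X Y : C) : Submodule k (X ⟶ Y) where
  carrier := {f | IsProjectivelyTrivial E f}
  add_mem' := fun {f g} hf hg A => by rw [hE.pull_add, hf A, hg A, add_zero]
  zero_mem' := fun A => by simpa using hE.pull_smul A 0 (0 : X ⟶ Y)
  smul_mem' := fun r f hf A => by rw [hE.pull_smul, hf A, smul_zero]

variable {E} in
/-- The morphisms from `X` to `Y` in the stable category. -/
abbrev StableHom (hE : IsBilinear E) (X Y : C) : Type v :=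
  (X ⟶ Y) ⧸ projTrivial hE X Y

variable {E} in
/-- `K` belongs to `C_l`: the functor `D𝔼(-, K)` from the stable category to `k`-modules is
representable, that is, isomorphic to the functor of the stable morphisms from some object `T`. The
morphism `Y ⟶ Y'` in the stable category represented by `f` is sent by the one functor to
composition with `f`, by the other to the dual of `𝔼(f, K)`. -/
def MemCl (hE : IsBilinear E) (K : C) : Prop :=
  ∃ (T : C) (ψ : ∀ Y : C, StableHom hE T Y ≃ₗ[k] D k (ExtMod E Y K)),
    ∀ (Y Y' : C) (f : Y ⟶ Y') (g : T ⟶ Y),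
      ψ Y' (Submodule.Quotient.mk (g ≫ f)) =
        (ψ Y (Submodule.Quotient.mk g)).comp (pull E K f)

end Stable

end NExangulated

open NExangulated

/-! Call `g^* δ` a multiple of the extension `δ`. A morphism `g` factors through the last
differential of a realization of `δ` exactly when `g^* δ = 0`. So that differential is right
`T`-determined exactly when morphisms from `T` detect all nonzero multiples of `δ`.

If `T` represents `D𝔼(-, K)`, it detects every nonzero element of each `𝔼(L, K)`, since `ǩ`
cogenerates. So every exangle that starts at `K` ends in a right `T`-determined deflation, and it
remains to find one whose other differentials are radical. Each indecomposable summand of `K`, not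
being injective, has a nonzero extension, and the direct sum of these has a radical first
differential (`exists_extension_isRadical_dFirst`). Contractible summands are then cancelled in the
middle (`NComplex.exists_homotopyEquivalent_isRadical`), which also makes the last differential
right minimal.

Conversely, let an exangle have a radical first differential and a right `T`-determined last one,
and let `K'` be an indecomposable summand of `K`. The composite of `K' ⟶ K` with the first
differential is a nonsplit inflation; `T` detects the nonzero multiples of its extension. Any two
nonzero elements of `𝔼(-, K')` have a common nonzero multiple (`exists_common_pull`), and `𝔼(T, K')`
is artinian, so some nonzero `ε` is a multiple of every nonzero element. Restricted to an
indecomposable summand `Z` of `T`, it is an almost split class and also generates the socle of `𝔼(Z,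
-)`. Linear forms that do not vanish on these classes give, over all summands of `K`, a pairing of
`C(⨁ Z, Y)` with `𝔼(Y, K)` that is nondegenerate modulo projectively trivial morphisms. As `D`
preserves length, by minimality of `ǩ`, this represents `D𝔼(-, K)`. -/

namespace NExangulated

/-! ### Matlis-type duality for modules of finite length -/

section Duality

variable {k : Type u} [CommRing k]

/-- An injective module is retracted onto some essential extension of a given submodule. -/
theorem exists_essential_retract {I : Type u} [AddCommGroup I] [Module k I]
    (hI : Module.Injective k I) (S : Submodule k I) :
    ∃ E : Submodule k I, S ≤ E ∧ (∀ x ∈ E, x ≠ 0 → ∃ a : k, a • x ∈ S ∧ a • x ≠ 0) ∧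
      ∃ r : I →ₗ[k] E, ∀ e : E, r e = e := by
  classical
  let Ess : Set (Submodule k I) := {E | S ≤ E ∧ ∀ x ∈ E, x ≠ 0 → ∃ a : k, a • x ∈ S ∧ a • x ≠ 0}
  have hSE : S ∈ Ess := ⟨le_rfl, fun x hx h0 => ⟨1, by simpa using hx, by simpa using h0⟩⟩
  obtain ⟨E, hES, hEmax⟩ := zorn_le_nonempty₀ Ess (by
    intro c hc hch E hE
    refine ⟨sSup c, ⟨(hc hE).1.trans (le_sSup hE), ?_⟩, fun z hz => le_sSup hz⟩
    intro x hx
    obtain ⟨F, hF, hxF⟩ := (Submodule.mem_sSup_of_directed ⟨E, hE⟩ hch.directedOn).1 hx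
    exact (hc hF).2 x hxF) S hSE
  -- `C` is maximal with `C ∩ E = 0`, so `E` embeds into `I ⧸ C` as an essential submodule, and the
  -- inclusion of `E` extends to a map `g` on `I ⧸ C`. The image of `g` is still essential over `S`,
  -- so maximality of `E` forces it into `E`.
  obtain ⟨C, -, hCmax⟩ := zorn_le_nonempty₀ {C : Submodule k I | ∀ x ∈ C, x ∈ E → x = 0} (by
    intro c hc hch E hE
    refine ⟨sSup c, ?_, fun z hz => le_sSup hz⟩
    intro x hx
    obtain ⟨F, hF, hxF⟩ := (Submodule.mem_sSup_of_directed ⟨E, hE⟩ hch.directedOn).1 hx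
    exact hc hF x hxF) ⊥ (by intro x hx _; simpa using hx)
  have key : ∀ x ∉ C, ∃ a : k, ∃ c ∈ C, c + a • x ∈ E ∧ c + a • x ≠ 0 := by
    intro x hx
    by_contra! H
    have hle := hCmax.2 (y := C ⊔ Submodule.span k {x}) (by
      intro y hy hyE
      obtain ⟨c, hc, z, hz, rfl⟩ := Submodule.mem_sup.1 hy
      obtain ⟨a, rfl⟩ := Submodule.mem_span_singleton.1 hz
      exact H a c hc hyE) le_sup_left
    exact hx (hle (Submodule.mem_sup_right (Submodule.mem_span_singleton_self x)))
  obtain ⟨g, hg⟩ := Module.Injective.extension_property k I E (I ⧸ C) (C.mkQ ∘ₗ E.subtype) (by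
    rw [← LinearMap.ker_eq_bot, LinearMap.ker_eq_bot']
    rintro ⟨e, he⟩ h0
    have : e ∈ C := by simpa using h0
    exact Subtype.ext (hCmax.1 e this he)) E.subtype
  have hgE : ∀ e (_ : e ∈ E), g (C.mkQ e) = e := fun e he => LinearMap.congr_fun hg ⟨e, he⟩
  have hga : ∀ x (a : k), ∀ c ∈ C, c + a • x ∈ E → a • g (C.mkQ x) = c + a • x := by
    intro x a c hc h
    have h1 := hgE _ h
    have h2 : C.mkQ c = 0 := by simpa using hc
    rwa [map_add, h2, zero_add, map_smul, map_smul] at h1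
  have hE2 := hEmax.1.2
  have hrange : LinearMap.range g ≤ E := by
    refine hEmax.2 (y := LinearMap.range g) ⟨?_, ?_⟩ ?_
    · exact fun e he => ⟨_, hgE e (hES he)⟩
    · rintro _ ⟨y, rfl⟩ h0
      obtain ⟨x, rfl⟩ := C.mkQ_surjective y
      have hx : x ∉ C := by
        intro hx
        apply h0
        rw [show C.mkQ x = 0 by simpa using hx, map_zero]
      obtain ⟨a, c, hc, hE', hne⟩ := key x hx
      obtain ⟨b, hb, hb0⟩ := hE2 _ hE' hne
      rw [← hga x a c hc hE', smul_smul] at hb hb0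
      exact ⟨b * a, hb, hb0⟩
    · exact fun e he => ⟨_, hgE e he⟩
  exact ⟨E, hES, hE2, LinearMap.codRestrict E (g ∘ₗ C.mkQ) fun x => hrange ⟨_, rfl⟩,
    fun e => Subtype.ext (hgE e e.2)⟩

/-- A module map to an injective module extends along injections, in any universe. -/
theorem exists_extension {J : Type u} [AddCommGroup J] [Module k J] (hJ : Module.Injective k J)
    {M : Type v} {N : Type w} [AddCommGroup M] [Module k M] [AddCommGroup N] [Module k N]
    (i : M →ₗ[k] N) (hi : Function.Injective i) (f : M →ₗ[k] J) :
    ∃ g : N →ₗ[k] J, g ∘ₗ i = f :=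
  (Module.Baer.of_injective hJ).extension_property i hi f

/-- If an element of an injective module is annihilated by whatever annihilates `z`, then `z` can be
mapped to it. -/
theorem exists_map_eq_of_torsionOf_le {J : Type u} [AddCommGroup J] [Module k J]
    (hJ : Module.Injective k J) {M : Type w} [AddCommGroup M] [Module k M] (z : M) (y : J)
    (h : ∀ a : k, a • z = 0 → a • y = 0) : ∃ f : M →ₗ[k] J, f z = y := by
  let t : (k ⧸ Ideal.torsionOf k M z) →ₗ[k] J :=
    (Ideal.torsionOf k M z).liftQ (LinearMap.toSpanSingleton k J y) (by
      intro a ha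
      simpa using h a (by simpa using ha))
  obtain ⟨f, hf⟩ := exists_extension hJ (k ∙ z).subtype Subtype.val_injective
    (t ∘ₗ (Ideal.quotTorsionOfEquivSpanSingleton k M z).symm.toLinearMap)
  refine ⟨f, ?_⟩
  have h1 := LinearMap.congr_fun hf ⟨z, Submodule.mem_span_singleton_self z⟩
  have h2 : (Ideal.quotTorsionOfEquivSpanSingleton k M z).symm
      ⟨z, Submodule.mem_span_singleton_self z⟩ = Submodule.Quotient.mk 1 := by
    rw [LinearEquiv.symm_apply_eq, Ideal.quotTorsionOfEquivSpanSingleton_apply_mk, one_smul]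
  simp only [LinearMap.comp_apply, LinearEquiv.coe_coe, h2] at h1
  refine h1.trans ?_
  exact (Submodule.liftQ_apply _ _ _).trans (by simp)

/-- Maps from cyclic submodules extend by injectivity, so only the simple modules `k ⧸ m` have to
embed. -/
theorem IsInjectiveCogenerator.of_forall_isMaximal {J : Type u} [AddCommGroup J] [Module k J]
    (hJ : Module.Injective k J)
    (h : ∀ m : Ideal k, m.IsMaximal → ∃ y : J, y ≠ 0 ∧ ∀ a ∈ m, a • y = 0) :
    IsInjectiveCogenerator k J where
  injective := hJ
  cogenerates M _ _ _ x hx := by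
    obtain ⟨m, hm, hle⟩ := Ideal.exists_le_maximal (Ideal.torsionOf k M x) (by simpa using hx)
    obtain ⟨y, hy, hmy⟩ := h m hm
    obtain ⟨f, hf⟩ := exists_map_eq_of_torsionOf_le hJ x y
      fun a ha => hmy a (hle (by simpa using ha))
    exact ⟨f, hf ▸ hy⟩

theorem IsInjectiveCogenerator.exists_ne_zero_of_isMaximal {J : Type u} [AddCommGroup J]
    [Module k J] (hJ : IsInjectiveCogenerator k J) (m : Ideal k) (hm : m.IsMaximal) :
    ∃ y : J, y ≠ 0 ∧ ∀ a ∈ m, a • y = 0 := by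
  have h1 : (Submodule.Quotient.mk 1 : k ⧸ m) ≠ 0 := fun h =>
    hm.ne_top ((Ideal.eq_top_iff_one _).2 ((Submodule.Quotient.mk_eq_zero m).1 h))
  obtain ⟨f, hf⟩ := hJ.cogenerates (k ⧸ m) _ h1
  refine ⟨_, hf, fun a ha => ?_⟩
  rw [← map_smul, ← Submodule.Quotient.mk_smul, (Submodule.Quotient.mk_eq_zero m).2, map_zero]
  simpa using ha

/-- The definition tests finitely generated modules in the universe of `k` only; passing through
elements killed by a maximal ideal removes both restrictions. -/
theorem IsInjectiveCogenerator.exists_apply_ne_zero {J : Type u} [AddCommGroup J] [Module k J]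
    (hJ : IsInjectiveCogenerator k J) {M : Type w} [AddCommGroup M] [Module k M] (x : M)
    (hx : x ≠ 0) : ∃ f : M →ₗ[k] J, f x ≠ 0 := by
  obtain ⟨m, hm, hle⟩ := Ideal.exists_le_maximal (Ideal.torsionOf k M x) (by simpa using hx)
  obtain ⟨y, hy, hmy⟩ := hJ.exists_ne_zero_of_isMaximal m hm
  obtain ⟨f, hf⟩ := exists_map_eq_of_torsionOf_le hJ.injective x y
    fun a ha => hmy a (hle (by simpa using ha))
  exact ⟨f, hf ▸ hy⟩

theorem mem_span_singleton_of_isMaximal {M : Type w} [AddCommGroup M] [Module k M] {m : Ideal k}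
    (hm : m.IsMaximal) {x : M} (hx : ∀ a ∈ m, a • x = 0) {S : Submodule k M} {a : k}
    (ha : a • x ∈ S) (ha0 : a • x ≠ 0) : x ∈ S := by
  have ham : a ∉ m := fun h => ha0 (hx a h)
  obtain ⟨b, hb⟩ := hm.exists_inv ham
  obtain ⟨c, hc, h⟩ := hb
  have : x = b • a • x := by
    conv_lhs => rw [← one_smul k x, ← h, add_smul, hx c hc, add_zero, mul_smul]
  rw [this]
  exact S.smul_mem _ ha

/-- The part of a minimal injective cogenerator that is annihilated by a maximal ideal is at most
one-dimensional. -/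
theorem IsMinimalInjectiveCogenerator.mem_span_singleton {J : Type u} [AddCommGroup J] [Module k J]
    (hJ : IsMinimalInjectiveCogenerator k J) {m : Ideal k} (hm : m.IsMaximal) {x y : J}
    (hy0 : y ≠ 0) (hx : ∀ a ∈ m, a • x = 0) (hy : ∀ a ∈ m, a • y = 0) : x ∈ k ∙ y := by
  by_contra hxy
  -- `J` is the direct sum of `E` and `ker r`. The complement `ker r` does not contain `y`, yet
  -- turns out to be an injective cogenerator, against minimality.
  obtain ⟨E, hE, hess, r, hr⟩ := exists_essential_retract hJ.injective (k ∙ y)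
  have hker : ∀ z : J, z - r z ∈ LinearMap.ker r := fun z => by simp [hr]
  let p : J →ₗ[k] LinearMap.ker r :=
    (LinearMap.id - E.subtype ∘ₗ r).codRestrict (LinearMap.ker r) hker
  have hp : ∀ z : LinearMap.ker r, p z = z := fun z => by
    apply Subtype.ext
    change (z : J) - r z = z
    rw [LinearMap.mem_ker.1 z.2, Submodule.coe_zero, sub_zero]
  have hNinj : Module.Injective k (LinearMap.ker r) := ⟨fun X Y _ _ _ _ f hf h => by
    obtain ⟨h', hh'⟩ := hJ.injective.out f hf ((LinearMap.ker r).subtype ∘ₗ h)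
    exact ⟨p ∘ₗ h', fun x => by simp [hh', hp]⟩⟩
  have hr0 : ∀ (m' : Ideal k) (z : J), (∀ a ∈ m', a • z = 0) → ∀ a ∈ m', a • p z = 0 :=
    fun m' z hz a ha => by rw [← map_smul, hz a ha, map_zero]
  have hmem : ∀ z : J, p z = 0 → z ∈ E := by
    intro z hz
    have : z = r z := sub_eq_zero.1 (congrArg Subtype.val hz)
    rw [this]
    exact (r z).2
  have hN : LinearMap.ker r = ⊤ := by
    refine hJ.minimal _ (.of_forall_isMaximal hNinj fun m' hm' => ?_)
    obtain ⟨t, ht0, ht⟩ := hJ.exists_ne_zero_of_isMaximal m' hm'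
    -- If `t` has no component in `ker r`, it lies in `E` and has a nonzero multiple in `k ∙ y`,
    -- which forces `m' = m`. Then `x` replaces `t`: it would lie in `k ∙ y` if its component
    -- vanished.
    by_cases hpt : p t = 0
    · obtain ⟨b, hb, hb0⟩ := hess t (hmem t hpt) ht0
      obtain ⟨c, hc⟩ := Submodule.mem_span_singleton.1 hb
      have hmm : m = m' := by
        by_contra hne
        obtain ⟨a, ha, a', ha', h1⟩ := Submodule.mem_sup.1
          ((hm.coprime_of_ne hm' hne) ▸ Submodule.mem_top : (1 : k) ∈ m ⊔ m')
        apply hb0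
        rw [← one_smul k (b • t), ← h1, add_smul, smul_comm a' b, ht a' ha', smul_zero, add_zero,
          ← hc, smul_comm, hy a ha, smul_zero]
      subst hmm
      refine ⟨p x, fun h => ?_, hr0 m x hx⟩
      obtain ⟨a, ha, ha0⟩ := hess x (hmem x h) fun h0 => hxy (h0 ▸ Submodule.zero_mem _)
      exact hxy (mem_span_singleton_of_isMaximal hm hx ha ha0)
    · exact ⟨p t, hpt, hr0 m' t ht⟩
  have hyE : y ∈ E := hE (Submodule.mem_span_singleton_self y)
  have : r y = 0 := LinearMap.mem_ker.1 (hN ▸ Submodule.mem_top)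
  apply hy0
  simpa [this] using (congrArg Subtype.val (hr ⟨y, hyE⟩)).symm

/-- The dual of a simple module is simple. -/
theorem isSimpleModule_dual {M : Type w} [AddCommGroup M] [Module k M] [IsSimpleModule k M] :
    IsSimpleModule k (D k M) := by
  have hJ := isMinimalInjectiveCogenerator_kCheck k
  have := IsSimpleModule.nontrivial k M
  obtain ⟨x, hx⟩ := exists_ne (0 : M)
  have hspan : k ∙ x = ⊤ := IsSimpleModule.span_singleton_eq_top k hx
  obtain ⟨m, hm, hle⟩ := Ideal.exists_le_maximal (Ideal.torsionOf k M x) (by simpa using hx)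
  have hmx : ∀ a ∈ m, a • x = 0 := by
    have hmax : (Ideal.torsionOf k M x).IsMaximal :=
      IsSimpleModule.ker_toSpanSingleton_isMaximal k hx
    intro a ha
    rw [← hmax.eq_of_le hm.ne_top hle] at ha
    simpa using ha
  -- A form on `M = k ∙ x` is determined by its value at `x`, and this value lies in the part of `ǩ`
  -- killed by `m`, which is at most one-dimensional.
  have hann : ∀ f : D k M, ∀ a ∈ m, a • f x = 0 := fun f a ha => by
    rw [← map_smul, hmx a ha, map_zero]
  have hext : ∀ f g : D k M, f x = g x → f = g := fun f g h =>
    LinearMap.ext_on_range (v := fun _ : Unit => x) (by simpa using hspan) fun _ => h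
  obtain ⟨f₀, hf₀⟩ := hJ.exists_apply_ne_zero x hx
  have : Nontrivial (D k M) := ⟨f₀, 0, fun h => hf₀ (by rw [h]; rfl)⟩
  rw [isSimpleModule_iff_toSpanSingleton_surjective]
  refine ⟨this, fun f hf g => ?_⟩
  have hfx : f x ≠ 0 := fun h => hf (hext _ _ (by simpa using h))
  obtain ⟨a, ha⟩ := Submodule.mem_span_singleton.1
    (hJ.mem_span_singleton hm hfx (hann g) (hann f))
  exact ⟨a, hext _ _ (by simpa using ha)⟩

/-- The duality preserves the length of modules of finite length. -/
theorem length_dual {M : Type w} [AddCommGroup M] [Module k M] (h : IsFiniteLength k M) :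
    Module.length k (D k M) = Module.length k M := by
  induction h with
  | of_subsingleton =>
    rw [Module.length_eq_zero, Module.length_eq_zero]
  | @of_simple_quotient M _ _ N _ _ ih =>
    have := isSimpleModule_dual (k := k) (M := M ⧸ N)
    have hJ := isMinimalInjectiveCogenerator_kCheck k
    rw [Module.length_eq_add_of_exact N.subtype N.mkQ N.injective_subtype N.mkQ_surjective
        (LinearMap.exact_subtype_mkQ N), ← ih,
      Module.length_eq_add_of_exact (LinearMap.lcomp k (kCheck k) N.mkQ)
        (LinearMap.lcomp k (kCheck k) N.subtype)
        (fun f g hfg => LinearMap.cancel_right N.mkQ_surjective |>.1 hfg)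
        (fun f => exists_extension hJ.injective N.subtype N.injective_subtype f) ?_,
      Module.length_eq_one k (D k (M ⧸ N)), Module.length_eq_one k (M ⧸ N), add_comm]
    intro f
    constructor
    · intro hf
      have hle : N ≤ LinearMap.ker f := fun x hx => LinearMap.congr_fun hf ⟨x, hx⟩
      exact ⟨N.liftQ f hle, N.liftQ_mkQ f hle⟩
    · rintro ⟨g, rfl⟩
      ext x
      simp [(Submodule.Quotient.mk_eq_zero N).2 x.2]

/-- A submodule of the dual of a module of finite length is everything as soon as it separates
points. -/
theorem eq_top_of_separates {M : Type w} [AddCommGroup M] [Module k M] (h : IsFiniteLength k M)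
    (V : Submodule k (D k M)) (hV : ∀ x : M, x ≠ 0 → ∃ f ∈ V, f x ≠ 0) : V = ⊤ := by
  have hDM : IsFiniteLength k (D k M) := by
    rw [← Module.length_ne_top_iff, length_dual h]
    exact Module.length_ne_top_iff.2 h
  have hVf : IsFiniteLength k V := hDM.of_injective V.injective_subtype
  -- As `V` separates points, evaluation embeds `M` into `D V`. So `V` is at least as long as `M`,
  -- hence as `D M`.
  have h1 : Module.length k M ≤ Module.length k V := by
    rw [← length_dual hVf]
    refine Module.length_le_of_injective (LinearMap.flip V.subtype) ?_
    rw [← LinearMap.ker_eq_bot, LinearMap.ker_eq_bot']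
    intro x hx
    by_contra hx0
    obtain ⟨f, hf, hfx⟩ := hV x hx0
    exact hfx (LinearMap.congr_fun hx ⟨f, hf⟩)
  by_contra hne
  obtain ⟨_, _⟩ := isFiniteLength_iff_isNoetherian_isArtinian.1 hDM
  have := Submodule.length_lt hne
  rw [length_dual h] at this
  exact absurd h1 (not_le.2 this)

theorem isFiniteLength_of_finite [IsArtinianRing k] (M : Type w) [AddCommGroup M] [Module k M]
    [Module.Finite k M] : IsFiniteLength k M :=
  isFiniteLength_iff_isNoetherian_isArtinian.2 ⟨inferInstance, inferInstance⟩

end Duality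

/-! ### The radical, and decompositions into summands with local endomorphism rings -/

section Radical

variable {C : Type u} [Category.{v} C] [Preadditive C]

theorem isIso_one_sub_comp_swap {X Y : C} (f : X ⟶ Y) (g : Y ⟶ X) (h : IsIso (𝟙 X - f ≫ g)) :
    IsIso (𝟙 Y - g ≫ f) := by
  obtain ⟨t, h1, h2⟩ := h
  -- Suggested by the formal geometric series `∑ (gf)^i = 1 + g (∑ (fg)^i) f`.
  refine ⟨𝟙 Y + g ≫ t ≫ f, ?_, ?_⟩
  · have h3 : (𝟙 X - f ≫ g) ≫ t ≫ f = f := by rw [← Category.assoc, h1, Category.id_comp]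
    have h4 : (𝟙 Y - g ≫ f) ≫ g = g ≫ (𝟙 X - f ≫ g) := by simp
    rw [Preadditive.comp_add, Category.comp_id, ← Category.assoc, h4, Category.assoc, h3]
    abel
  · have h3 : t ≫ (𝟙 X - f ≫ g) ≫ f = f := by rw [← Category.assoc, h2, Category.id_comp]
    have h4 : f ≫ (𝟙 Y - g ≫ f) = (𝟙 X - f ≫ g) ≫ f := by simp
    rw [Preadditive.add_comp, Category.id_comp, Category.assoc, Category.assoc, h4, h3]
    abel

namespace IsRadical

variable {X Y Z : C}

theorem comp_left {f : Y ⟶ Z} (hf : IsRadical f) (h : X ⟶ Y) : IsRadical (h ≫ f) := fun g => by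
  rw [Category.assoc]
  refine isIso_one_sub_comp_swap _ _ ?_
  rw [Category.assoc]
  exact hf _

theorem zero : IsRadical (0 : X ⟶ Y) := fun g => by
  rw [zero_comp, sub_zero]
  infer_instance

theorem add {f g : X ⟶ Y} (hf : IsRadical f) (hg : IsRadical g) : IsRadical (f + g) := fun h => by
  have := hf h
  have := hg.comp_left (inv (𝟙 X - f ≫ h)) h
  have e : 𝟙 X - (f + g) ≫ h =
      (𝟙 X - f ≫ h) ≫ (𝟙 X - (inv (𝟙 X - f ≫ h) ≫ g) ≫ h) := by
    rw [Preadditive.comp_sub, Category.assoc, IsIso.hom_inv_id_assoc, Category.comp_id,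
      Preadditive.add_comp]
    abel
  rw [e]
  infer_instance

theorem sum {ι : Type*} (s : Finset ι) (f : ι → (X ⟶ Y)) (hf : ∀ i ∈ s, IsRadical (f i)) :
    IsRadical (∑ i ∈ s, f i) := by
  classical
  induction s using Finset.induction with
  | empty => simpa using zero
  | insert a s ha ih =>
    rw [Finset.sum_insert ha]
    exact (hf a (Finset.mem_insert_self a s)).add
      (ih fun i hi => hf i (Finset.mem_insert_of_mem hi))

end IsRadical

theorem isIso_or_isIso_one_sub {W : C} [IsLocalRing (End W)] (f : W ⟶ W) :
    IsIso f ∨ IsIso (𝟙 W - f) := by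
  have h := IsLocalRing.isUnit_or_isUnit_of_add_one (R := End W) (a := f) (b := 𝟙 W - f)
    (add_sub_cancel f (𝟙 W))
  rwa [isUnit_iff_isIso, isUnit_iff_isIso] at h

theorem not_isZero_of_isLocalRing {W : C} [IsLocalRing (End W)] : ¬ IsZero W := fun h =>
  one_ne_zero (α := End W) (h.eq_of_src _ _)

theorem one_ne_zero_of_isLocalRing (W : C) [IsLocalRing (End W)] : 𝟙 W ≠ 0 := fun h =>
  one_ne_zero (α := End W) h

/-- A nonradical morphism whose source has a local endomorphism ring is a split monomorphism. -/
theorem exists_retraction_of_not_isRadical {W Q : C} [IsLocalRing (End W)] {f : W ⟶ Q}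
    (hf : ¬ IsRadical f) : ∃ r : Q ⟶ W, f ≫ r = 𝟙 W := by
  simp only [IsRadical, not_forall] at hf
  obtain ⟨g, hg⟩ := hf
  have := (isIso_or_isIso_one_sub (f ≫ g)).resolve_right hg
  exact ⟨g ≫ inv (f ≫ g), by rw [← Category.assoc, IsIso.hom_inv_id]⟩

theorem IsRadical.comp_ne_one {W X Q : C} [IsLocalRing (End W)] {f : X ⟶ Q} (hf : IsRadical f)
    (u : W ⟶ X) (v : Q ⟶ W) : u ≫ f ≫ v ≠ 𝟙 W := fun h => by
  have h1 := (hf.comp_left u) v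
  rw [Category.assoc, h, sub_self] at h1
  refine one_ne_zero_of_isLocalRing W ?_
  rw [← IsIso.hom_inv_id (0 : W ⟶ W), zero_comp]

/-- If `W` with local endomorphism ring is a retract of `V` with local endomorphism ring, then it is
isomorphic to it. -/
theorem isIso_of_comp_eq_one {V W : C} [IsLocalRing (End V)] [IsLocalRing (End W)] {f : V ⟶ W}
    {g : W ⟶ V} (h : f ≫ g = 𝟙 V) : IsIso f := by
  have hid : (g ≫ f) ≫ g ≫ f = g ≫ f := by
    rw [Category.assoc, reassoc_of% h]
  rcases isIso_or_isIso_one_sub (g ≫ f) with h1 | h1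
  · exact ⟨g, h, by rwa [← cancel_epi (g ≫ f), Category.comp_id]⟩
  · have h2 : g ≫ f = 0 := by
      rw [← cancel_epi (𝟙 W - g ≫ f), Preadditive.sub_comp, hid]
      simp
    exfalso
    apply one_ne_zero_of_isLocalRing V
    calc 𝟙 V = f ≫ (g ≫ f) ≫ g := by rw [Category.assoc, h, Category.comp_id, h]
      _ = 0 := by rw [h2, zero_comp, comp_zero]

/-- A decomposition of an object into `m` direct summands with local endomorphism rings. -/
structure LocalDecomposition (m : ℕ) (X : C) where
  summand : Fin m → C
  isLocalRing : ∀ i, IsLocalRing (End (summand i))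
  inc : ∀ i, summand i ⟶ X
  proj : ∀ i, X ⟶ summand i
  inc_proj_self : ∀ i, inc i ≫ proj i = 𝟙 _
  inc_proj_of_ne : ∀ i j, i ≠ j → inc i ≫ proj j = 0
  sum_proj_inc : ∑ i, proj i ≫ inc i = 𝟙 X

namespace LocalDecomposition

variable {m : ℕ} {P Q : C}

attribute [instance] isLocalRing

theorem hom_ext (S : LocalDecomposition m P) {f g : P ⟶ Q}
    (h : ∀ i, S.inc i ≫ f = S.inc i ≫ g) : f = g := by
  rw [← Category.id_comp f, ← Category.id_comp g, ← S.sum_proj_inc, Preadditive.sum_comp,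
    Preadditive.sum_comp]
  exact Finset.sum_congr rfl fun i _ => by rw [Category.assoc, Category.assoc, h]

/-- Radical morphisms are closed under sums, so some component of `d` is nonradical, and such a
morphism from an object with local endomorphism ring splits. -/
theorem exists_comp_eq_one_of_not_isRadical (S : LocalDecomposition m P) {d : P ⟶ Q}
    (hd : ¬ IsRadical d) : ∃ i, ∃ v : Q ⟶ S.summand i, S.inc i ≫ d ≫ v = 𝟙 _ := by
  by_contra! H
  apply hd
  rw [← Category.id_comp d, ← S.sum_proj_inc, Preadditive.sum_comp]
  refine IsRadical.sum _ _ fun i _ => ?_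
  rw [Category.assoc]
  refine IsRadical.comp_left ?_ _
  by_contra h
  obtain ⟨r, hr⟩ := exists_retraction_of_not_isRadical h
  exact H i r (by rw [← hr, Category.assoc])

variable [HasFiniteBiproducts C]

theorem exists_of_isKrullSchmidt (h : IsKrullSchmidt C) (X : C) :
    ∃ m, Nonempty (LocalDecomposition m X) := by
  obtain ⟨m, Y, hY, ⟨e⟩⟩ := h X
  refine ⟨m, ⟨Y, hY, fun i => biproduct.ι Y i ≫ e.inv, fun i => e.hom ≫ biproduct.π Y i, ?_, ?_,
    ?_⟩⟩
  · simp
  · intro i j hij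
    simp [biproduct.ι_π_ne _ hij]
  · simp_rw [Category.assoc]
    rw [← Preadditive.comp_sum]
    simp_rw [← Category.assoc]
    rw [← Preadditive.sum_comp, biproduct.total]
    simp

/-- The biproduct of the summands. -/
noncomputable def ofBiproduct {m : ℕ} (Y : Fin m → C) (hY : ∀ i, IsLocalRing (End (Y i))) :
    LocalDecomposition m (⨁ Y) where
  summand := Y
  isLocalRing := hY
  inc := biproduct.ι Y
  proj := biproduct.π Y
  inc_proj_self := by simp
  inc_proj_of_ne i j hij := biproduct.ι_π_ne _ hij
  sum_proj_inc := biproduct.total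

/-- The exchange property: a direct summand with local endomorphism ring has a complement that is a
direct sum of all but one of the given summands. -/
theorem exists_complement {m : ℕ} {P W : C} (S : LocalDecomposition m P) [IsLocalRing (End W)]
    (u : W ⟶ P) (v : P ⟶ W) (huv : u ≫ v = 𝟙 W) :
    ∃ (m' : ℕ) (P' : C) (i : P' ⟶ P) (p : P ⟶ P'), m = m' + 1 ∧
      Nonempty (LocalDecomposition m' P') ∧ i ≫ p = 𝟙 P' ∧ p ≫ i = 𝟙 P - v ≫ u := by
  have hv : ¬ IsRadical v := fun h => (h.comp_left u).comp_ne_one (𝟙 W) (𝟙 W) (by simpa using huv)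
  obtain ⟨j, t, ht⟩ := S.exists_comp_eq_one_of_not_isRadical hv
  have : IsIso (S.inc j ≫ v) := isIso_of_comp_eq_one (g := t) (by rw [Category.assoc, ht])
  obtain ⟨t, ht⟩ : ∃ t, t = inv (S.inc j ≫ v) := ⟨_, rfl⟩
  have ht1 : S.inc j ≫ v ≫ t = 𝟙 _ := by rw [← Category.assoc, ht, IsIso.hom_inv_id]
  have ht2 : t ≫ S.inc j ≫ v = 𝟙 _ := by rw [ht, IsIso.inv_hom_id]
  obtain _ | m := m
  · exact j.elim0
  let P' : C := ⨁ fun l => S.summand (j.succAbove l)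
  let i' : P' ⟶ P := biproduct.desc fun l => S.inc (j.succAbove l)
  let p' : P ⟶ P' := biproduct.lift fun l => S.proj (j.succAbove l)
  have hi'p' : i' ≫ p' = 𝟙 P' := by
    ext a b
    by_cases hab : a = b
    · subst hab
      simp [i', p', S.inc_proj_self]
    · have h1 := S.inc_proj_of_ne (j.succAbove b) (j.succAbove a)
        (fun h => hab (Fin.succAbove_right_injective h.symm))
      simp [i', p', h1, biproduct.ι_π_ne _ (Ne.symm hab)]
  have hp'i' : p' ≫ i' = 𝟙 P - S.proj j ≫ S.inc j := by
    rw [eq_sub_iff_add_eq, ← S.sum_proj_inc, Fin.sum_univ_succAbove _ j, add_comm,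
      biproduct.lift_desc]
  have hjp' : S.inc j ≫ p' = 0 := by
    ext b
    have h1 := S.inc_proj_of_ne j (j.succAbove b) (Fin.succAbove_ne j b).symm
    simp [p', h1]
  have hi'j : i' ≫ S.proj j = 0 := by
    ext b
    have h1 := S.inc_proj_of_ne (j.succAbove b) j (Fin.succAbove_ne j b)
    simp [i', h1]
  -- Both `S.summand j` and `W` are complements of the kernel of `v`. The inclusion moves the other
  -- summands into this kernel along `S.summand j`; the projection goes to the kernel along `W` and
  -- then drops the component `j`.
  refine ⟨m, P', i' ≫ (𝟙 P - v ≫ t ≫ S.inc j), (𝟙 P - v ≫ u) ≫ p', rfl,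
    ⟨ofBiproduct _ fun l => S.isLocalRing _⟩, ?_, ?_⟩
  · have h1 : (𝟙 P - v ≫ t ≫ S.inc j) ≫ v = 0 := by
      rw [Preadditive.sub_comp, Category.assoc, Category.assoc, ht2]
      simp
    have h2 : (𝟙 P - v ≫ t ≫ S.inc j) ≫ (𝟙 P - v ≫ u) = 𝟙 P - v ≫ t ≫ S.inc j := by
      rw [Preadditive.comp_sub, Category.comp_id, reassoc_of% h1, zero_comp, sub_zero]
    have h3 : (𝟙 P - v ≫ t ≫ S.inc j) ≫ p' = p' := by
      simp [Preadditive.sub_comp, hjp']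
    rw [Category.assoc, reassoc_of% h2, h3, hi'p']
  · have h1 : (𝟙 P - v ≫ u) ≫ v = 0 := by simp [Preadditive.sub_comp, huv]
    have h2 : (𝟙 P - S.proj j ≫ S.inc j) ≫ (𝟙 P - v ≫ t ≫ S.inc j) = 𝟙 P - v ≫ t ≫ S.inc j := by
      rw [Preadditive.sub_comp, Preadditive.comp_sub _ _ (_ ≫ _)]
      simp [reassoc_of% ht1]
    rw [Category.assoc, reassoc_of% hp'i', h2, Preadditive.comp_sub, reassoc_of% h1, zero_comp,
      sub_zero, Category.comp_id]

end LocalDecomposition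

end Radical

/-! ### Functoriality and additivity of `𝔼` -/

section Extensions

variable {k : Type u'} [CommRing k] {C : Type u} [Category.{v} C]
variable (E : Cᵒᵖ ⥤ C ⥤ ModuleCat.{w} k)

@[simp]
theorem push_id {A Z : C} (x : ExtMod E Z A) : push E Z (𝟙 A) x = x := by
  simp [push]

@[simp]
theorem pull_id {A Z : C} (x : ExtMod E Z A) : pull E A (𝟙 Z) x = x := by
  simp [pull]

theorem push_comp {A A' A'' Z : C} (a : A ⟶ A') (b : A' ⟶ A'') (x : ExtMod E Z A) :
    push E Z (a ≫ b) x = push E Z b (push E Z a x) := by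
  simp [push]

theorem pull_comp {A Z Z' Z'' : C} (c : Z'' ⟶ Z') (d : Z' ⟶ Z) (x : ExtMod E Z A) :
    pull E A (c ≫ d) x = pull E A c (pull E A d x) := by
  simp [pull]

theorem pull_push {A A' Z Z' : C} (a : A ⟶ A') (c : Z' ⟶ Z) (x : ExtMod E Z A) :
    pull E A' c (push E Z a x) = push E Z' a (pull E A c x) := by
  have := (E.map c.op).naturality a
  exact LinearMap.congr_fun (congrArg ModuleCat.Hom.hom this) x

end Extensions

namespace IsBilinear

variable {k : Type u'} [CommRing k] {C : Type u} [Category.{v} C] [Preadditive C] [Linear k C]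
variable {E : Cᵒᵖ ⥤ C ⥤ ModuleCat.{w} k} (hE : IsBilinear E)
include hE

theorem push_zero {A A' : C} (Z : C) : push E Z (0 : A ⟶ A') = 0 := by
  simpa using hE.push_smul Z 0 (0 : A ⟶ A')

theorem pull_zero {Z Z' : C} (A : C) : pull E A (0 : Z' ⟶ Z) = 0 := by
  simpa using hE.pull_smul A 0 (0 : Z' ⟶ Z)

theorem pull_sub {Z Z' : C} (A : C) (a b : Z' ⟶ Z) : pull E A (a - b) = pull E A a - pull E A b := by
  rw [eq_sub_iff_add_eq, ← hE.pull_add, sub_add_cancel]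

theorem push_sum {A A' : C} (Z : C) {ι : Type*} (t : Finset ι) (a : ι → (A ⟶ A')) :
    push E Z (∑ i ∈ t, a i) = ∑ i ∈ t, push E Z (a i) :=
  map_sum (AddMonoidHom.mk' (fun f : A ⟶ A' => push E Z f) (hE.push_add Z)) a t

theorem pull_sum {Z Z' : C} (A : C) {ι : Type*} (t : Finset ι) (a : ι → (Z' ⟶ Z)) :
    pull E A (∑ i ∈ t, a i) = ∑ i ∈ t, pull E A (a i) :=
  map_sum (AddMonoidHom.mk' (fun f : Z' ⟶ Z => pull E A f) (hE.pull_add A)) a t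

end IsBilinear

/-! ### Exactness of the long sequences at `𝔼` -/

section Exactness

variable {k : Type u'} [CommRing k] {C : Type u} [Category.{v} C] [Preadditive C] [Linear k C]
variable {E : Cᵒᵖ ⥤ C ⥤ ModuleCat.{w} k} {n : ℕ} {s : Correspondence E n}

omit [Linear k C] in
theorem exists_realizes (s : Correspondence E n) {A Z : C} (δ : ExtMod E Z A) :
    ∃ X : NComplex n A Z, Realizes s X δ := by
  obtain ⟨X, hX⟩ := Quotient.exists_rep (s δ)
  exact ⟨X, hX.symm⟩

variable [HasFiniteBiproducts C]

/-- The sequence `C(W, Z) ⟶ 𝔼(W, A) ⟶ 𝔼(W, X₁)` attached to a distinguished `n`-exangle is exact. -/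
theorem IsNExangulated.exists_pull_eq (hE : IsBilinear E) (hs : IsNExangulated s) (hn : 1 ≤ n)
    {A Z W : C} {δ : ExtMod E Z A} {X : NComplex n A Z} (hX : Realizes s X δ) (μ : ExtMod E W A)
    (hμ : push E W X.dFirst μ = 0) : ∃ g : W ⟶ Z, pull E A g δ = μ := by
  have := HasBinaryBiproducts.of_hasBinaryProducts (C := C)
  -- A good lift over the inclusion of `Z` has a mapping cone that realizes `(dFirst)_* ρ = 0`.
  -- Hence `biprod.inr` lifts to the cone term `Z ⊞ Pₙ`, and pulling `ρ` back along the resulting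
  -- expression leaves only the contribution of `Z`, a multiple of `δ`.
  obtain ⟨ρ, hρ⟩ : ∃ ρ : ExtMod E (Z ⊞ W) A,
      ρ = pull E A biprod.fst δ + pull E A biprod.snd μ := ⟨_, rfl⟩
  have hZ : pull E A biprod.inl ρ = δ := by
    rw [hρ, map_add, ← pull_comp, ← pull_comp]
    simp [hE.pull_zero]
  have hW : pull E A biprod.inr ρ = μ := by
    rw [hρ, map_add, ← pull_comp, ← pull_comp]
    simp [hE.pull_zero]
  have hρ0 : push E (Z ⊞ W) X.dFirst ρ = 0 := by
    rw [hρ, map_add, ← pull_push, ← pull_push, (hs.isNExangle _ _ hX).push_dFirst, hμ]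
    simp
  obtain ⟨P, hP⟩ := exists_realizes s ρ
  obtain ⟨f, hf, M, ⟨p, q, -, hq, -, -, -, hM⟩, hMr⟩ :=
    hs.good_lift ρ biprod.inl X P (by rwa [hZ]) hP
  rw [hρ0] at hMr
  obtain ⟨h, hh⟩ := (hs.isNExangle _ _ hMr).exact_contra_last W biprod.inr (map_zero _)
  have hlast : M.dLast = (p n ≫ X.right.hom) ≫ biprod.inl + q n ≫ P.dLast := by
    rw [NComplex.dLast, ← hq, reassoc_of% (hM n hn le_rfl).2, Preadditive.add_comp,
      Category.assoc, hf.2, Category.assoc, Category.assoc, NComplex.dLast]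
  refine ⟨h ≫ p n ≫ X.right.hom, ?_⟩
  have h0 : pull E A (h ≫ q n ≫ P.dLast) ρ = 0 := by
    rw [pull_comp, pull_comp, (hs.isNExangle _ _ hP).pull_dLast, map_zero, map_zero]
  have h1 : h ≫ q n ≫ P.dLast = biprod.inr - (h ≫ p n ≫ X.right.hom) ≫ biprod.inl := by
    rw [← hh, hlast]
    simp
  rw [h1, hE.pull_sub, LinearMap.sub_apply, hW, pull_comp, hZ] at h0
  exact (sub_eq_zero.1 h0).symm

/-- The sequence `C(A, B) ⟶ 𝔼(Z, B) ⟶ 𝔼(Xₙ, B)` attached to a distinguished `n`-exangle is exact. -/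
theorem IsNExangulated.exists_push_eq (hE : IsBilinear E) (hs : IsNExangulated s) (hn : 1 ≤ n)
    {A Z B : C} {δ : ExtMod E Z A} {V : NComplex n A Z} (hV : Realizes s V δ) (μ : ExtMod E Z B)
    (hμ : pull E B V.dLast μ = 0) : ∃ g : A ⟶ B, push E Z g δ = μ := by
  have := HasBinaryBiproducts.of_hasBinaryProducts (C := C)
  obtain ⟨ρ, hρ⟩ : ∃ ρ : ExtMod E Z (A ⊞ B),
      ρ = push E Z biprod.inl δ + push E Z biprod.inr μ := ⟨_, rfl⟩
  have hA : push E Z biprod.fst ρ = δ := by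
    rw [hρ, map_add, ← push_comp, ← push_comp]
    simp [hE.push_zero]
  have hB : push E Z biprod.snd ρ = μ := by
    rw [hρ, map_add, ← push_comp, ← push_comp]
    simp [hE.push_zero]
  have hρ0 : pull E (A ⊞ B) V.dLast ρ = 0 := by
    rw [hρ, map_add, pull_push, pull_push, (hs.isNExangle _ _ hV).pull_dLast, hμ]
    simp
  obtain ⟨X, hX⟩ := exists_realizes s ρ
  obtain ⟨f, hf, N, ⟨p, q, hp, -, hlim, hN, hN0, -⟩, hNr⟩ :=
    hs.good_colift ρ biprod.fst X V hX (by rwa [hA])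
  rw [hρ0] at hNr
  obtain ⟨h, hh⟩ := (hs.isNExangle _ _ hNr).exact_co_first B biprod.snd (map_zero _)
  -- The cocone term in degree `1` is given only as a product; `i₁` and `i₂` are the inclusions that
  -- make it a biproduct and split `h` into its parts on `X₁` and `A`. The part on `X₁` contributes
  -- nothing, since `X.dFirst` kills `ρ`.
  obtain ⟨l⟩ := hlim 0 hn
  obtain ⟨i₁, hi₁⟩ := BinaryFan.IsLimit.lift' l (𝟙 (X.cx.X 1)) (0 : X.cx.X 1 ⟶ V.cx.X 0)
  obtain ⟨i₂, hi₂⟩ := BinaryFan.IsLimit.lift' l (0 : V.cx.X 0 ⟶ X.cx.X 1) (𝟙 (V.cx.X 0))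
  dsimp at i₁ i₂ hi₁ hi₂
  have hid : p 1 ≫ i₁ + q 0 ≫ i₂ = 𝟙 (N.cx.X 1) := by
    refine BinaryFan.IsLimit.hom_ext l ?_ ?_
    · simp [hi₁.1, hi₂.1]
    · simp [hi₁.2, hi₂.2]
  have hd : N.dFirst ≫ p 1 = X.dFirst := by
    rw [NComplex.dFirst, Category.assoc, hN 0 hn, ← Category.assoc, NComplex.dFirst]
    congr 1
    rw [Iso.inv_comp_eq, ← hp, Category.assoc, Iso.hom_inv_id, Category.comp_id]
  have hd' : N.dFirst ≫ q 0 = biprod.fst ≫ V.left.inv := by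
    rw [NComplex.dFirst, Category.assoc, hN0, Iso.inv_comp_eq, ← hp, ← cancel_mono V.left.hom]
    simp [hf.1]
  refine ⟨V.left.inv ≫ i₂ ≫ h, ?_⟩
  have h1 : biprod.snd = X.dFirst ≫ i₁ ≫ h + biprod.fst ≫ V.left.inv ≫ i₂ ≫ h := by
    rw [← hh]
    conv_lhs => rw [← Category.id_comp h, ← hid]
    rw [Preadditive.add_comp, Preadditive.comp_add, Category.assoc, Category.assoc,
      reassoc_of% hd, reassoc_of% hd']
  have h2 := hB
  rw [h1, hE.push_add, LinearMap.add_apply, push_comp, (hs.isNExangle _ _ hX).push_dFirst,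
    map_zero, zero_add, push_comp, hA] at h2
  exact h2

end Exactness

/-! ### Representability of `D𝔼(-, K)` through pairings -/

section Pairing

variable {k : Type u'} [CommRing k] {C : Type u} [Category.{v} C] [Preadditive C] [Linear k C]
variable {E : Cᵒᵖ ⥤ C ⥤ ModuleCat.{w} k}

/-- A linear form on `𝔼(T, K)` induces a pairing between `C(T, Y)` and `𝔼(Y, K)`. -/
noncomputable def pairing (hE : IsBilinear E) {T K : C} (Φ : D k (ExtMod E T K)) (Y : C) :
    (T ⟶ Y) →ₗ[k] D k (ExtMod E Y K) where
  toFun g := Φ ∘ₗ pull E K g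
  map_add' f g := by rw [hE.pull_add, LinearMap.comp_add]
  map_smul' r f := by rw [hE.pull_smul, LinearMap.comp_smul, RingHom.id_apply]

/-- The functor `D𝔼(-, K)` is represented by `T` as soon as some linear form on `𝔼(T, K)` induces
nondegenerate pairings. -/
theorem memCl_of_pairing [IsArtinianRing k] (hE : IsBilinear E) (hfin : IsExtFinite E) {T K : C}
    (Φ : D k (ExtMod E T K))
    (hsep : ∀ (Y : C) (μ : ExtMod E Y K), μ ≠ 0 → ∃ g : T ⟶ Y, Φ (pull E K g μ) ≠ 0)
    (htriv : ∀ (Y : C) (g : T ⟶ Y), (∀ μ, Φ (pull E K g μ) = 0) → IsProjectivelyTrivial E g) :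
    MemCl hE K := by
  have hle : ∀ Y, projTrivial hE T Y ≤ LinearMap.ker (pairing hE Φ Y) := by
    intro Y g hg
    rw [LinearMap.mem_ker]
    ext μ
    change Φ (pull E K g μ) = 0
    rw [show pull E K g = 0 from hg K, LinearMap.zero_apply, map_zero]
  let L : ∀ Y, StableHom hE T Y →ₗ[k] D k (ExtMod E Y K) := fun Y =>
    (projTrivial hE T Y).liftQ (pairing hE Φ Y) (hle Y)
  have hL : ∀ Y (g : T ⟶ Y), L Y (Submodule.Quotient.mk g) = Φ ∘ₗ pull E K g := fun Y g =>
    Submodule.liftQ_apply _ _ _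
  have hbij : ∀ Y, Function.Bijective (L Y) := by
    intro Y
    constructor
    · rw [← LinearMap.ker_eq_bot, LinearMap.ker_eq_bot']
      intro x hx
      obtain ⟨g, rfl⟩ := Submodule.Quotient.mk_surjective _ x
      rw [hL] at hx
      exact (Submodule.Quotient.mk_eq_zero _).2 (htriv Y g fun μ => LinearMap.congr_fun hx μ)
    -- Here the length count enters: separating the points of `𝔼(Y, K)` already gives surjectivity.
    · have := hfin Y K
      rw [← LinearMap.range_eq_top]
      refine eq_top_of_separates (isFiniteLength_of_finite (k := k) (ExtMod E Y K)) _ fun μ hμ => ?_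
      obtain ⟨g, hg⟩ := hsep Y μ hμ
      exact ⟨_, ⟨Submodule.Quotient.mk g, hL Y g⟩, hg⟩
  refine ⟨T, fun Y => LinearEquiv.ofBijective (L Y) (hbij Y), fun Y Y' f g => ?_⟩
  rw [LinearEquiv.ofBijective_apply, LinearEquiv.ofBijective_apply, hL, hL]
  ext μ
  simp [pull_comp]

/-- An object that represents `D𝔼(-, K)` detects the nonzero elements of `𝔼(L, K)`. -/
theorem MemCl.exists_pull_ne_zero {hE : IsBilinear E} {K : C} (h : MemCl hE K) :
    ∃ T : C, ∀ (L : C) (ε : ExtMod E L K), ε ≠ 0 → ∃ g : T ⟶ L, pull E K g ε ≠ 0 := by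
  obtain ⟨T, ψ, hψ⟩ := h
  refine ⟨T, fun L ε hε => ?_⟩
  obtain ⟨F, hF⟩ := (isMinimalInjectiveCogenerator_kCheck k).exists_apply_ne_zero ε hε
  obtain ⟨x, rfl⟩ := (ψ L).surjective F
  obtain ⟨g, rfl⟩ := Submodule.Quotient.mk_surjective _ x
  refine ⟨g, fun h0 => hF ?_⟩
  -- Yoneda: the form that belongs to `g` is `g^*` followed by the form that belongs to `𝟙 T`.
  have h1 := hψ T L g (𝟙 T)
  rw [Category.id_comp] at h1
  rw [h1, LinearMap.comp_apply, h0, map_zero]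

end Pairing

/-! ### Determined morphisms in terms of extensions -/

section Determined

variable {k : Type u'} [CommRing k] {C : Type u} [Category.{v} C] [Preadditive C]
variable {E : Cᵒᵖ ⥤ C ⥤ ModuleCat.{w} k} {n : ℕ}

theorem IsNExangle.factorsThrough_dLast_iff {A Z L : C} {X : NComplex n A Z} {δ : ExtMod E Z A}
    (hX : IsNExangle E X δ) (g : L ⟶ Z) : FactorsThrough g X.dLast ↔ pull E A g δ = 0 := by
  constructor
  · rintro ⟨t, rfl⟩
    rw [pull_comp, hX.pull_dLast, map_zero]
  · exact hX.exact_contra_last L g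

theorem IsNExangle.isRightDetermined_dLast_iff {A Z T : C} {X : NComplex n A Z} {δ : ExtMod E Z A}
    (hX : IsNExangle E X δ) : IsRightDetermined X.dLast T ↔
      ∀ (L : C) (g : L ⟶ Z), pull E A g δ ≠ 0 → ∃ h : T ⟶ L, pull E A h (pull E A g δ) ≠ 0 := by
  simp only [IsRightDetermined, hX.factorsThrough_dLast_iff, pull_comp]
  refine forall_congr' fun L => forall_congr' fun g => ?_
  rw [← not_imp_not, not_forall]

/-- If the differential before the last one lies in the radical, then the last one is right
minimal. -/
theorem IsNExangle.isRightMinimal_dLast {A Z : C} {X : NComplex (n + 1) A Z} {δ : ExtMod E Z A}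
    (hX : IsNExangle E X δ) (hrad : IsRadical (X.cx.d n (n + 1))) : IsRightMinimal X.dLast := by
  intro e he
  have h0 : (𝟙 _ - e) ≫ X.cx.d (n + 1) (n + 2) = 0 := by
    rw [← cancel_mono X.right.hom, Category.assoc, zero_comp]
    change (𝟙 _ - e) ≫ X.dLast = 0
    rw [Preadditive.sub_comp, he, Category.id_comp, sub_self]
  -- Exactness factors `𝟙 - e` through a radical morphism, so `e` is invertible.
  obtain ⟨h, hh⟩ := hX.exact_contra _ n (Nat.lt_succ_self n) _ h0
  have h1 := hrad.comp_left h (𝟙 _)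
  rwa [hh, Category.comp_id, sub_sub_cancel] at h1

omit [Preadditive C] in
theorem isRightDetermined_of_rightEquivalent {X X' Y T : C} {f : X ⟶ Y} {f' : X' ⟶ Y}
    (h : RightEquivalent f' f) (hf : IsRightDetermined f T) : IsRightDetermined f' T := by
  obtain ⟨⟨a, ha⟩, ⟨b, hb⟩⟩ := h
  intro L g hg
  obtain ⟨t, ht⟩ := hf L g fun h => by
    obtain ⟨t, ht⟩ := hg h
    exact ⟨t ≫ a, by rw [Category.assoc, ha, ht]⟩
  exact ⟨t ≫ b, by rw [Category.assoc, hb, ht]⟩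

end Determined

/-! ### Noninjective summands and radical first differentials -/

section Summands

variable {k : Type u'} [CommRing k] {C : Type u} [Category.{v} C] [Preadditive C]
variable {E : Cᵒᵖ ⥤ C ⥤ ModuleCat.{w} k} {n : ℕ} {s : Correspondence E n}
variable [HasFiniteBiproducts C]

theorem HasNoInjectiveSummands.not_isInjectiveObject {K : C} (hK : HasNoInjectiveSummands s K)
    {m : ℕ} (S : LocalDecomposition m K) (j : Fin m) : ¬ IsInjectiveObject s (S.summand j) := by
  have := HasBinaryBiproducts.of_hasBinaryProducts (C := C)
  intro hinj
  obtain ⟨-, J, i, p, -, -, hip, hpi⟩ :=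
    S.exists_complement (S.inc j) (S.proj j) (S.inc_proj_self j)
  have h1 : S.inc j ≫ p = 0 := by
    have h2 : S.inc j ≫ p ≫ i = 0 := by
      rw [hpi, Preadditive.comp_sub, reassoc_of% S.inc_proj_self j]
      simp
    rw [← Category.comp_id p, ← hip, reassoc_of% h2, zero_comp]
  have h2 : i ≫ S.proj j = 0 := by
    have h3 : p ≫ i ≫ S.proj j = 0 := by
      rw [reassoc_of% hpi, Preadditive.sub_comp, Category.assoc, S.inc_proj_self]
      simp
    rw [← Category.id_comp i, ← hip, Category.assoc, Category.assoc, h3, comp_zero]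
  refine not_isZero_of_isLocalRing (hK (S.summand j) J ⟨?_⟩ hinj)
  refine ⟨biprod.lift (S.proj j) p, biprod.desc (S.inc j) i, ?_, ?_⟩
  · rw [biprod.lift_desc, hpi]
    abel
  · ext
    · simp [S.inc_proj_self]
    · simp [h1]
    · simp [h2]
    · simp [hip]

omit [HasFiniteBiproducts C] in
theorem exists_ne_zero_of_not_isInjectiveObject (hs : IsExactRealization s) {I : C}
    (hI : ¬ IsInjectiveObject s I) : ∃ (Z : C) (δ : ExtMod E Z I), δ ≠ 0 := by
  simp only [IsInjectiveObject, not_forall] at hI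
  obtain ⟨A, Z, δ, X, hX, g, hg⟩ := hI
  exact ⟨Z, push E Z g δ, fun h => hg ((hs.isNExangle _ _ hX).exact_co_first _ g h)⟩

/-- An object without injective summands is the left end term of an extension all of whose
realizations begin with a radical morphism. -/
theorem exists_extension_isRadical_dFirst (hKS : IsKrullSchmidt C) [Linear k C] (hE : IsBilinear E)
    (hs : IsExactRealization s) {K : C} (hK : HasNoInjectiveSummands s K) :
    ∃ (Y : C) (δ : ExtMod E Y K), ∀ X : NComplex n K Y, Realizes s X δ → IsRadical X.dFirst := by
  obtain ⟨m, ⟨S⟩⟩ := LocalDecomposition.exists_of_isKrullSchmidt hKS K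
  choose Z δ hδ using fun j =>
    exists_ne_zero_of_not_isInjectiveObject hs (hK.not_isInjectiveObject S j)
  refine ⟨⨁ Z, ∑ j, pull E K (biproduct.π Z j) (push E (Z j) (S.inc j) (δ j)), fun X hX => ?_⟩
  by_contra hrad
  obtain ⟨j, v, hv⟩ := S.exists_comp_eq_one_of_not_isRadical hrad
  apply hδ j
  -- Restricting to `Z j` leaves the `j`-th term of the sum, and pushing along `v` after `dFirst`
  -- returns `δ j` because `v` splits `S.inc j ≫ dFirst`.
  have h0 := congrArg (fun x => pull E _ (biproduct.ι Z j) (push E _ v x))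
    (hs.isNExangle _ _ hX).push_dFirst
  simp only [← push_comp, map_zero] at h0
  rw [pull_push, map_sum, Finset.sum_eq_single j] at h0
  · simpa [← pull_comp, ← push_comp, hv] using h0
  · intro l _ hl
    rw [← pull_comp, biproduct.ι_π_ne _ hl.symm, hE.pull_zero, LinearMap.zero_apply]
  · simp

end Summands

/-! ### Cancelling contractible summands of a complex -/

section Splitting

variable {C : Type u} [Category.{v} C] [Preadditive C] {n : ℕ}

/-- The retract of a complex that splits an idempotent endomorphism degreewise. -/
def retractComplex (K : CochainComplex C ℕ) (e : K ⟶ K) (S : ℕ → C) (i : ∀ j, S j ⟶ K.X j)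
    (p : ∀ j, K.X j ⟶ S j) (hpi : ∀ j, p j ≫ i j = e.f j) :
    CochainComplex C ℕ where
  X := S
  d a b := i a ≫ K.d a b ≫ p b
  shape a b h := by rw [K.shape a b h, zero_comp, comp_zero]
  d_comp_d' a b c _ _ := by
    have h : p b ≫ i b ≫ K.d b c = K.d b c ≫ e.f c := by
      rw [← Category.assoc, hpi, e.comm]
    simp only [Category.assoc]
    rw [reassoc_of% h, K.d_comp_d_assoc, zero_comp, comp_zero]

/-- Splitting an idempotent that is homotopic to the identity, and equal to it at the end terms,
does not change the homotopy class of a complex. -/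
theorem NComplex.exists_homotopyEquivalent_of_splitting {A Z : C} (X : NComplex n A Z)
    (e : X.cx ⟶ X.cx) (he : Nonempty (Homotopy e (𝟙 X.cx))) (he0 : e.f 0 = 𝟙 _)
    (heZ : e.f (n + 1) = 𝟙 _) (S : ℕ → C) (i : ∀ j, S j ⟶ X.cx.X j)
    (p : ∀ j, X.cx.X j ⟶ S j) (hip : ∀ j, i j ≫ p j = 𝟙 _) (hpi : ∀ j, p j ≫ i j = e.f j) :
    ∃ X' : NComplex n A Z, X'.cx.X = S ∧ NComplex.HomotopyEquivalent X X' := by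
  let X' : NComplex n A Z :=
    { cx := retractComplex X.cx e S i p hpi
      isZero := fun j hj => by
        rw [IsZero.iff_id_eq_zero]
        change 𝟙 (S j) = 0
        rw [← hip, (X.isZero j hj).eq_of_src (p j) 0, comp_zero]
      left := (⟨i 0, p 0, hip 0, by rw [hpi, he0]⟩ : S 0 ≅ X.cx.X 0) ≪≫ X.left
      right := (⟨i (n + 1), p (n + 1), hip _, by rw [hpi, heZ]⟩ : S (n + 1) ≅ X.cx.X (n + 1)) ≪≫
        X.right }
  let P : X.cx ⟶ X'.cx :=
    { f := p
      comm' := fun a b _ => by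
        change p a ≫ i a ≫ X.cx.d a b ≫ p b = X.cx.d a b ≫ p b
        rw [← Category.assoc, hpi, e.comm_assoc, ← hpi, Category.assoc, hip, Category.comp_id] }
  let I : X'.cx ⟶ X.cx :=
    { f := i
      comm' := fun a b _ => by
        change i a ≫ X.cx.d a b = (i a ≫ X.cx.d a b ≫ p b) ≫ i b
        rw [Category.assoc, Category.assoc, hpi, ← e.comm, ← hpi, Category.assoc,
          ← Category.assoc (i a) (p a), hip, Category.id_comp] }
  have hPI : P ≫ I = e := by
    ext j
    exact hpi j
  have hIP : I ≫ P = 𝟙 X'.cx := by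
    ext j
    exact hip j
  refine ⟨X', rfl, P, I, ⟨?_, ?_⟩, ⟨?_, ?_⟩, ?_, ⟨Homotopy.ofEq hIP⟩⟩
  · change p 0 ≫ i 0 ≫ X.left.hom = _
    rw [← Category.assoc, hpi, he0, Category.id_comp, Category.comp_id]
  · change p (n + 1) ≫ i (n + 1) ≫ X.right.hom = _
    rw [← Category.assoc, hpi, heZ, Category.id_comp, Category.comp_id]
  · change i 0 ≫ X.left.hom = (i 0 ≫ X.left.hom) ≫ 𝟙 _
    rw [Category.comp_id]
  · change i (n + 1) ≫ X.right.hom = (i (n + 1) ≫ X.right.hom) ≫ 𝟙 _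
    rw [Category.comp_id]
  · rwa [hPI]

variable [HasFiniteBiproducts C]

/-- A nonradical differential allows to split off a contractible direct summand. -/
theorem NComplex.exists_homotopyEquivalent_of_not_isRadical {A Z : C} (X : NComplex n A Z)
    (m : ℕ → ℕ) (hm : ∀ j, Nonempty (LocalDecomposition (m j) (X.cx.X j))) (a : ℕ) (ha : 0 < a)
    (han : a < n) (hd : ¬ IsRadical (X.cx.d a (a + 1))) :
    ∃ (X' : NComplex n A Z) (m' : ℕ → ℕ), NComplex.HomotopyEquivalent X X' ∧
      (∀ j, Nonempty (LocalDecomposition (m' j) (X'.cx.X j))) ∧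
      (∀ j, m' j ≤ m j) ∧ m' a < m a := by
  obtain ⟨D⟩ := hm a
  obtain ⟨D'⟩ := hm (a + 1)
  obtain ⟨l, v, huv⟩ := D.exists_comp_eq_one_of_not_isRadical hd
  -- A homotopy concentrated between degrees `a + 1` and `a`. The map `e = 𝟙 - (dt + td)` splits off
  -- the contractible summand and differs from the identity only in degrees `a` and `a + 1`, which
  -- are inner because `0 < a < n`.
  let t : ∀ j, X.cx.X (j + 1) ⟶ X.cx.X j :=
    Function.update (fun j => (0 : X.cx.X (j + 1) ⟶ X.cx.X j)) a (v ≫ D.inc l)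
  have ht : t a = v ≫ D.inc l := Function.update_self _ _ _
  have ht0 : ∀ j, j ≠ a → t j = 0 := fun j hj => Function.update_of_ne hj _ _
  let h : ∀ i j, (ComplexShape.up ℕ).Rel j i → (X.cx.X i ⟶ X.cx.X j) := fun i j r =>
    eqToHom (congrArg X.cx.X (show i = j + 1 from Eq.symm r)) ≫ t j
  let e : X.cx ⟶ X.cx := 𝟙 _ - Homotopy.nullHomotopicMap' h
  have he0 : e.f 0 = 𝟙 _ - X.cx.d 0 1 ≫ t 0 := by
    have := Homotopy.nullHomotopicMap'_f_of_not_rel_right (c := ComplexShape.up ℕ)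
      (k₁ := 0) (k₀ := 1) (show 0 + 1 = 1 from rfl) (by simp) h
    simp only [e, HomologicalComplex.sub_f_apply, this, h, HomologicalComplex.id_f]
    simp
  have hes : ∀ j, e.f (j + 1) = 𝟙 _ - (X.cx.d (j + 1) (j + 2) ≫ t (j + 1) +
      t j ≫ X.cx.d j (j + 1)) := by
    intro j
    have := Homotopy.nullHomotopicMap'_f (c := ComplexShape.up ℕ)
      (k₂ := j) (k₁ := j + 1) (k₀ := j + 2) rfl rfl h
    simp only [e, HomologicalComplex.sub_f_apply, this, h, HomologicalComplex.id_f]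
    simp
  have hea : e.f a = 𝟙 _ - (X.cx.d a (a + 1) ≫ v) ≫ D.inc l := by
    obtain ⟨b, rfl⟩ : ∃ b, a = b + 1 := ⟨a - 1, by omega⟩
    rw [hes, ht, ht0 b (by omega), zero_comp, add_zero, Category.assoc]
  have hea' : e.f (a + 1) = 𝟙 _ - v ≫ (D.inc l ≫ X.cx.d a (a + 1)) := by
    rw [hes, ht, ht0 (a + 1) (by omega), comp_zero, zero_add, Category.assoc]
  have hej : ∀ j, j ≠ a → j ≠ a + 1 → e.f j = 𝟙 _ := by
    intro j h1 h2
    obtain _ | j := j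
    · rw [he0, ht0 0 h1, comp_zero, sub_zero]
    · rw [hes, ht0 _ h1, ht0 j (by omega), comp_zero, zero_comp, add_zero, sub_zero]
  obtain ⟨m₁, P₁, i₁, p₁, hm₁, hD₁, hip₁, hpi₁⟩ :=
    D.exists_complement (D.inc l) (X.cx.d a (a + 1) ≫ v) huv
  obtain ⟨m₂, P₂, i₂, p₂, hm₂, hD₂, hip₂, hpi₂⟩ :=
    D'.exists_complement (D.inc l ≫ X.cx.d a (a + 1)) v (by rw [Category.assoc, huv])
  have hsplit : ∀ j, ∃ (S : C) (i : S ⟶ X.cx.X j) (p : X.cx.X j ⟶ S) (m' : ℕ),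
      i ≫ p = 𝟙 _ ∧ p ≫ i = e.f j ∧ Nonempty (LocalDecomposition m' S) ∧ m' ≤ m j ∧
      (j = a → m' < m j) := by
    intro j
    by_cases h1 : j = a
    · subst h1
      exact ⟨P₁, i₁, p₁, m₁, hip₁, hpi₁.trans hea.symm, hD₁, by omega, by omega⟩
    by_cases h2 : j = a + 1
    · subst h2
      exact ⟨P₂, i₂, p₂, m₂, hip₂, hpi₂.trans hea'.symm, hD₂, by omega, by omega⟩
    · exact ⟨_, 𝟙 _, 𝟙 _, m j, by simp, by rw [hej j h1 h2, Category.comp_id], hm j, le_rfl,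
        fun h => absurd h h1⟩
  choose S i p m' hip hpi hS hle hlt using hsplit
  have hhom : Nonempty (Homotopy e (𝟙 X.cx)) :=
    ⟨(Homotopy.equivSubZero.symm
      ((Homotopy.ofEq (sub_sub_cancel _ _)).trans (Homotopy.nullHomotopy' h))).symm⟩
  obtain ⟨X', hX', heq⟩ := X.exists_homotopyEquivalent_of_splitting e hhom
    (hej 0 (by omega) (by omega)) (hej (n + 1) (by omega) (by omega)) S i p hip hpi
  exact ⟨X', m', heq, fun j => hX' ▸ hS j, hle, hlt a rfl⟩

/-- In a Krull-Schmidt category, each complex is homotopy equivalent to one whose inner differentials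
are radical. -/
theorem NComplex.exists_homotopyEquivalent_isRadical (hKS : IsKrullSchmidt C) {A Z : C}
    (X : NComplex n A Z) : ∃ X' : NComplex n A Z, NComplex.HomotopyEquivalent X X' ∧
      ∀ a, 0 < a → a < n → IsRadical (X'.cx.d a (a + 1)) := by
  choose m hm using fun j => LocalDecomposition.exists_of_isKrullSchmidt hKS (X.cx.X j)
  -- The induction runs on the number of local summands in degrees below `n`: a cancellation at `a <
  -- n` lowers it in degree `a` and raises it nowhere.
  obtain ⟨N, hN⟩ : ∃ N, N = ∑ j ∈ Finset.range n, m j := ⟨_, rfl⟩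
  induction N using Nat.strong_induction_on generalizing X m with
  | _ N ih =>
    by_cases hrad : ∀ a, 0 < a → a < n → IsRadical (X.cx.d a (a + 1))
    · exact ⟨X, (homotopySetoid n A Z).iseqv.refl X, hrad⟩
    · push Not at hrad
      obtain ⟨a, ha, han, hd⟩ := hrad
      obtain ⟨X', m', heq, hm', hle, hlt⟩ :=
        X.exists_homotopyEquivalent_of_not_isRadical m hm a ha han hd
      have hsum : ∑ j ∈ Finset.range n, m' j < N := by
        rw [hN]
        exact Finset.sum_lt_sum (fun j _ => hle j) ⟨a, Finset.mem_range.2 han, hlt⟩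
      obtain ⟨X'', heq', h⟩ := ih _ hsum X' m' hm' rfl
      exact ⟨X'', (homotopySetoid n A Z).iseqv.trans heq heq', h⟩

end Splitting

/-! ### Inflations and their extensions -/

section Inflations

variable {k : Type u'} [CommRing k] {C : Type u} [Category.{v} C] [Preadditive C]
variable {E : Cᵒᵖ ⥤ C ⥤ ModuleCat.{w} k} {n : ℕ} {s : Correspondence E n}

theorem Realizes.isInflation {A Z : C} {X : NComplex n A Z} {δ : ExtMod E Z A}
    (hX : Realizes s X δ) : IsInflation s X.dFirst :=
  ⟨Z, δ, X, Iso.refl _, hX, Category.comp_id _⟩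

theorem Realizes.isDeflation {A Z : C} {X : NComplex n A Z} {δ : ExtMod E Z A}
    (hX : Realizes s X δ) : IsDeflation s X.dLast :=
  ⟨A, δ, X, Iso.refl _, hX, Category.id_comp _⟩

theorem Realizes.of_homotopyEquivalent {A Z : C} {X X' : NComplex n A Z} {δ : ExtMod E Z A}
    (hX : Realizes s X δ) (h : NComplex.HomotopyEquivalent X X') : Realizes s X' δ :=
  Eq.trans hX (Quotient.sound h)

variable [HasFiniteBiproducts C]

open HomologicalComplex ZeroObject in
theorem isInflation_id (hs : IsExactRealization s) (hn : 1 ≤ n) (A : C) :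
    IsInflation s (𝟙 A) := by
  have : HasZeroObject C := hasZeroObject_of_hasFiniteBiproducts C
  have hr : (ComplexShape.up ℕ).Rel 0 1 := rfl
  have hz : ∀ i, 2 ≤ i → IsZero ((double (𝟙 A) hr).X i) := fun i hi =>
    isZero_double_X _ _ _ (by omega) (by omega)
  let X : NComplex n A (0 : C) :=
    { cx := double (𝟙 A) hr
      isZero := fun i hi => hz i (by omega)
      left := doubleXIso₀ _ hr
      right := (hz (n + 1) (by omega)).iso (isZero_zero C) }
  have hd : X.cx.d 0 1 = (doubleXIso₀ (𝟙 A) hr).hom ≫ 𝟙 A ≫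
      (doubleXIso₁ (𝟙 A) hr zero_ne_one).inv := double_d _ hr zero_ne_one
  refine ⟨0, 0, X, doubleXIso₁ _ hr zero_ne_one, hs.zero_right X ?_ hz, ?_⟩
  · rw [hd]
    infer_instance
  · rw [NComplex.dFirst, hd]
    simp [X]

theorem SatisfiesWIC.isInflation_of_comp_eq_id (hwic : SatisfiesWIC s) (hs : IsExactRealization s)
    (hn : 1 ≤ n) {A B : C} {i : A ⟶ B} {p : B ⟶ A} (h : i ≫ p = 𝟙 A) : IsInflation s i :=
  hwic.inflation_of_comp i p (h ▸ isInflation_id hs hn A)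

/-- The extension that belongs to an inflation. -/
theorem IsInflation.exists_extension [Linear k C] (hE : IsBilinear E) (hs : IsNExangulated s)
    (hn : 1 ≤ n) {A B : C} {f : A ⟶ B} (hf : IsInflation s f) :
    ∃ (Z : C) (δ : ExtMod E Z A), push E Z f δ = 0 ∧ (δ = 0 → ∃ r : B ⟶ A, f ≫ r = 𝟙 A) ∧
      ∀ (W : C) (μ : ExtMod E W A), push E W f μ = 0 → ∃ g : W ⟶ Z, pull E A g δ = μ := by
  obtain ⟨Z, δ, X, e, hX, rfl⟩ := hf
  have hx := hs.isNExangle _ _ hX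
  refine ⟨Z, δ, ?_, fun h0 => ?_, fun W μ hμ => hs.exists_pull_eq hE hn hX μ ?_⟩
  · rw [push_comp, hx.push_dFirst, map_zero]
  · obtain ⟨r, hr⟩ := hx.exact_co_first A (𝟙 A) (by rw [h0, map_zero])
    exact ⟨e.inv ≫ r, by simpa using hr⟩
  · have h1 := congrArg (push E W e.inv) hμ
    rw [← push_comp] at h1
    simpa using h1

end Inflations

/-! ### Socles of `𝔼(-, K)`, almost split extensions, and the two implications -/

section Socle

variable {k : Type u'} [CommRing k] {C : Type u} [Category.{v} C] [Preadditive C] [Linear k C]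
variable {E : Cᵒᵖ ⥤ C ⥤ ModuleCat.{w} k} {n : ℕ} {s : Correspondence E n}
variable [HasFiniteBiproducts C]

omit [Preadditive C] [Linear k C] [HasFiniteBiproducts C] in
theorem eq_zero_of_isIso_comp {A B Z : C} {f : A ⟶ B} {a : B ⟶ A} {μ : ExtMod E Z A}
    (hf : push E Z f μ = 0) (h : IsIso (f ≫ a)) : μ = 0 := by
  have h1 : push E Z ((f ≫ a) ≫ inv (f ≫ a)) μ = 0 := by
    rw [push_comp, push_comp, hf, map_zero, map_zero]
  rwa [IsIso.hom_inv_id, push_id] at h1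

/-- If `K` has a local endomorphism ring, then any two nonzero elements of the functor `𝔼(-, K)`
have a common nonzero multiple. -/
theorem exists_common_pull (hE : IsBilinear E) (hs : IsNExangulated s) (hwic : SatisfiesWIC s)
    (hn : 1 ≤ n) {K M N : C} [IsLocalRing (End K)] {μ : ExtMod E M K} {ν : ExtMod E N K}
    (hμ : μ ≠ 0) (hν : ν ≠ 0) : ∃ (P : C) (ρ : ExtMod E P K), ρ ≠ 0 ∧
      (∃ g : P ⟶ M, pull E K g μ = ρ) ∧ ∃ g : P ⟶ N, pull E K g ν = ρ := by
  have := HasBinaryBiproducts.of_hasBinaryProducts (C := C)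
  obtain ⟨X, hX⟩ := exists_realizes s μ
  obtain ⟨Y, hY⟩ := exists_realizes s ν
  -- `f` is an inflation because its first component is. Its extension `ρ` is killed by both first
  -- differentials, hence is a multiple of `μ` and of `ν`. If `f` split, locality of `End K` would
  -- split one of the two differentials.
  let f := biprod.lift X.dFirst Y.dFirst
  have hf1 : f ≫ biprod.fst = X.dFirst := biprod.lift_fst _ _
  have hf2 : f ≫ biprod.snd = Y.dFirst := biprod.lift_snd _ _
  have hf : IsInflation s f := hwic.inflation_of_comp f biprod.fst (hf1 ▸ hX.isInflation)
  obtain ⟨P, ρ, hρ, hρ0, -⟩ := hf.exists_extension hE hs hn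
  refine ⟨P, ρ, fun h0 => ?_, hs.exists_pull_eq hE hn hX ρ ?_, hs.exists_pull_eq hE hn hY ρ ?_⟩
  · obtain ⟨r, hr⟩ := hρ0 h0
    have h1 : X.dFirst ≫ biprod.inl ≫ r + Y.dFirst ≫ biprod.inr ≫ r = 𝟙 K := by
      rw [← hr, ← hf1, ← hf2, Category.assoc, Category.assoc, ← Preadditive.comp_add,
        ← Category.assoc biprod.fst, ← Category.assoc biprod.snd, ← Preadditive.add_comp,
        biprod.total, Category.id_comp]
    rcases isIso_or_isIso_one_sub (X.dFirst ≫ biprod.inl ≫ r) with h | h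
    · exact hμ (eq_zero_of_isIso_comp (hs.isNExangle _ _ hX).push_dFirst h)
    · rw [← h1, add_sub_cancel_left] at h
      exact hν (eq_zero_of_isIso_comp (hs.isNExangle _ _ hY).push_dFirst h)
  · rw [← hf1, push_comp, hρ, map_zero]
  · rw [← hf2, push_comp, hρ, map_zero]

/-- The value at `T` of the subfunctor of `𝔼(-, K)` generated by `ν`. -/
def pullSubmodule (hE : IsBilinear E) {K M : C} (T : C) (ν : ExtMod E M K) :
    Submodule k (ExtMod E T K) where
  carrier := {x | ∃ g : T ⟶ M, pull E K g ν = x}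
  add_mem' := by
    rintro _ _ ⟨g, rfl⟩ ⟨h, rfl⟩
    exact ⟨g + h, by rw [hE.pull_add, LinearMap.add_apply]⟩
  zero_mem' := ⟨0, by rw [hE.pull_zero, LinearMap.zero_apply]⟩
  smul_mem' := by
    rintro r _ ⟨g, rfl⟩
    exact ⟨r • g, by rw [hE.pull_smul, LinearMap.smul_apply]⟩

omit [HasFiniteBiproducts C] in
theorem pullSubmodule_pull_le (hE : IsBilinear E) {K M P : C} (T : C) (ν : ExtMod E M K)
    (g : P ⟶ M) : pullSubmodule hE T (pull E K g ν) ≤ pullSubmodule hE T ν := by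
  rintro _ ⟨h, rfl⟩
  exact ⟨h ≫ g, pull_comp _ _ _ _⟩

/-- If `T` detects the nonzero multiples of some nonzero element of `𝔼(-, K)`, where `K` has a local
endomorphism ring, then some nonzero element of `𝔼(T, K)` is a multiple of all the nonzero elements
of `𝔼(-, K)`. -/
theorem exists_mem_forall_pullSubmodule [IsArtinianRing k] (hE : IsBilinear E)
    (hfin : IsExtFinite E) (hs : IsNExangulated s) (hwic : SatisfiesWIC s) (hn : 1 ≤ n) {K M T : C}
    [IsLocalRing (End K)] {μ : ExtMod E M K} (hμ : μ ≠ 0)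
    (hT : ∀ (L : C) (g : L ⟶ M), pull E K g μ ≠ 0 → ∃ h : T ⟶ L, pull E K h (pull E K g μ) ≠ 0) :
    ∃ ε : ExtMod E T K, ε ≠ 0 ∧
      ∀ (N : C) (ν : ExtMod E N K), ν ≠ 0 → ∃ g : T ⟶ N, pull E K g ν = ε := by
  have := hfin T K
  let 𝒮 : Set (Submodule k (ExtMod E T K)) :=
    {V | ∃ (N : C) (ν : ExtMod E N K), ν ≠ 0 ∧ pullSubmodule hE T ν = V}
  obtain ⟨V, ⟨N₀, ν₀, hν₀, hV⟩, hmin⟩ := IsArtinian.set_has_minimal 𝒮 ⟨_, M, μ, hμ, rfl⟩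
  have hle : ∀ (N : C) (ν : ExtMod E N K), ν ≠ 0 → V ≤ pullSubmodule hE T ν := by
    intro N ν hν
    obtain ⟨P, ρ, hρ, ⟨g, rfl⟩, ⟨g', hg'⟩⟩ := exists_common_pull hE hs hwic hn hν₀ hν
    have h1 : pullSubmodule hE T (pull E K g ν₀) ≤ V := hV ▸ pullSubmodule_pull_le hE T ν₀ g
    have h2 := hmin _ ⟨P, _, hρ, rfl⟩
    rw [← eq_of_le_of_not_lt h1 h2, ← hg']
    exact pullSubmodule_pull_le hE T ν g'
  -- By now `V` lies in all the submodules, but could still be zero. A common multiple of `μ` and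
  -- `ν₀` is detected by `T`, being a multiple of `μ`, and so yields a nonzero element of `V`.
  obtain ⟨P, ρ, hρ, ⟨g, rfl⟩, ⟨g', hg'⟩⟩ := exists_common_pull hE hs hwic hn hμ hν₀
  obtain ⟨h, hh⟩ := hT P g hρ
  exact ⟨_, hh, fun N ν hν => hle N ν hν
    (hV ▸ pullSubmodule_pull_le hE T ν₀ g' ⟨h, by rw [hg']⟩)⟩

/-- An element of `𝔼(Z, K)` that generates the simple essential socles of `𝔼(-, K)` and of
`𝔼(Z, -)`: the class of an almost split `n`-exangle. -/
structure IsAlmostSplit {Z K : C} (ε : ExtMod E Z K) : Prop where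
  ne_zero : ε ≠ 0
  exists_pull : ∀ (N : C) (ν : ExtMod E N K), ν ≠ 0 → ∃ g : Z ⟶ N, pull E K g ν = ε
  exists_push : ∀ (A : C) (ν : ExtMod E Z A), ν ≠ 0 → ∃ g : A ⟶ K, push E Z g ν = ε

omit [HasFiniteBiproducts C] in
theorem LocalDecomposition.exists_pull_inc_ne_zero (hE : IsBilinear E) {m : ℕ} {T A : C}
    (S : LocalDecomposition m T) {ε : ExtMod E T A} (hε : ε ≠ 0) :
    ∃ j, pull E A (S.inc j) ε ≠ 0 := by
  by_contra! H
  apply hε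
  rw [← pull_id E ε, ← S.sum_proj_inc, hE.pull_sum, LinearMap.sum_apply]
  exact Finset.sum_eq_zero fun j _ => by rw [pull_comp, H, map_zero]

omit [HasFiniteBiproducts C] in
theorem LocalDecomposition.exists_push_proj_ne_zero (hE : IsBilinear E) {m : ℕ} {K Y : C}
    (S : LocalDecomposition m K) {μ : ExtMod E Y K} (hμ : μ ≠ 0) :
    ∃ j, push E Y (S.proj j) μ ≠ 0 := by
  by_contra! H
  apply hμ
  rw [← push_id E μ, ← S.sum_proj_inc, hE.push_sum, LinearMap.sum_apply]
  exact Finset.sum_eq_zero fun j _ => by rw [push_comp, H, map_zero]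

/-- For a realization `V` of `ν`, exactness makes `ε` a push of `ν` once `V.dLast` pulls `ε` back to
zero. Otherwise `ε = (g ≫ V.dLast)^* ε` for some `g`, and locality of `End Z` makes `ν` or `ε`
vanish. -/
theorem IsAlmostSplit.of_exists_pull (hE : IsBilinear E) (hs : IsNExangulated s) (hn : 1 ≤ n)
    {Z K : C} [IsLocalRing (End Z)] {ε : ExtMod E Z K} (hε : ε ≠ 0)
    (h : ∀ (N : C) (ν : ExtMod E N K), ν ≠ 0 → ∃ g : Z ⟶ N, pull E K g ν = ε) :
    IsAlmostSplit ε := by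
  refine ⟨hε, h, fun A ν hν => ?_⟩
  obtain ⟨V, hV⟩ := exists_realizes s ν
  refine hs.exists_push_eq hE hn hV ε ?_
  by_contra hne
  obtain ⟨g, hg⟩ := h _ _ hne
  rw [← pull_comp] at hg
  rcases isIso_or_isIso_one_sub (g ≫ V.dLast) with hi | hi
  · apply hν
    rw [← pull_id E ν, ← IsIso.inv_hom_id (g ≫ V.dLast), pull_comp, pull_comp,
      (hs.isNExangle _ _ hV).pull_dLast, map_zero, map_zero]
  · apply hε
    rw [← pull_id E ε, ← IsIso.inv_hom_id (𝟙 Z - g ≫ V.dLast), pull_comp, hE.pull_sub,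
      LinearMap.sub_apply, hg, pull_id, sub_self, map_zero]

/-- The class found over `T` is nonzero on some indecomposable summand. Restricted there, it is
still a multiple of all nonzero elements, and the local endomorphism ring needed for the covariant
half is available. -/
theorem exists_isAlmostSplit [IsArtinianRing k] (hKS : IsKrullSchmidt C) (hE : IsBilinear E)
    (hfin : IsExtFinite E) (hs : IsNExangulated s) (hwic : SatisfiesWIC s) (hn : 1 ≤ n) {K M T : C}
    [IsLocalRing (End K)] {μ : ExtMod E M K} (hμ : μ ≠ 0)
    (hT : ∀ (L : C) (g : L ⟶ M), pull E K g μ ≠ 0 → ∃ h : T ⟶ L, pull E K h (pull E K g μ) ≠ 0) :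
    ∃ (Z : C) (ε : ExtMod E Z K), IsAlmostSplit ε := by
  obtain ⟨ε, hε, h⟩ := exists_mem_forall_pullSubmodule hE hfin hs hwic hn hμ hT
  obtain ⟨m, ⟨S⟩⟩ := LocalDecomposition.exists_of_isKrullSchmidt hKS T
  obtain ⟨j, hj⟩ := S.exists_pull_inc_ne_zero hE hε
  refine ⟨S.summand j, _, .of_exists_pull hE hs hn hj fun N ν hν => ?_⟩
  obtain ⟨g, hg⟩ := h N ν hν
  exact ⟨S.inc j ≫ g, by rw [pull_comp, hg]⟩

/-- If the summands of `K` are left end terms of almost split `n`-exangles, then `D𝔼(-, K)` is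
representable. -/
theorem memCl_of_isAlmostSplit [IsArtinianRing k] (hE : IsBilinear E) (hfin : IsExtFinite E)
    {m : ℕ} {K : C} (S : LocalDecomposition m K)
    (h : ∀ j, ∃ (Z : C) (ε : ExtMod E Z (S.summand j)), IsAlmostSplit ε) : MemCl hE K := by
  choose Z ε hε using h
  choose φ hφ using fun j =>
    (isMinimalInjectiveCogenerator_kCheck k).exists_apply_ne_zero (ε j) (hε j).ne_zero
  let Φ : D k (ExtMod E (⨁ Z) K) :=
    ∑ j, φ j ∘ₗ pull E (S.summand j) (biproduct.ι Z j) ∘ₗ push E (⨁ Z) (S.proj j)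
  have hΦ : ∀ x, Φ x = ∑ j, φ j (pull E _ (biproduct.ι Z j) (push E _ (S.proj j) x)) := fun x => by
    simp [Φ]
  refine memCl_of_pairing hE hfin Φ (fun Y μ hμ => ?_) fun Y g hg A => ?_
  · obtain ⟨j, hj⟩ := S.exists_push_proj_ne_zero hE hμ
    obtain ⟨g, hg⟩ := (hε j).exists_pull Y _ hj
    refine ⟨biproduct.π Z j ≫ g, ?_⟩
    rw [hΦ, Finset.sum_eq_single j]
    · rw [← pull_push, ← pull_comp, biproduct.ι_π_self_assoc, hg]
      exact hφ j
    · intro l _ hl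
      rw [← pull_push, ← pull_comp, biproduct.ι_π_ne_assoc _ hl, zero_comp, hE.pull_zero,
        LinearMap.zero_apply, map_zero]
    · simp
  -- If `g^* ν ≠ 0`, some component of it can be pushed to `ε j`. Pushing `ν` itself along the same
  -- morphism and `S.inc j` gives an element of `𝔼(Y, K)` that pairs with `g` to `φ j (ε j) ≠ 0`.
  · ext ν
    by_contra hν
    have hι : ∃ j, pull E A (biproduct.ι Z j) (pull E A g ν) ≠ 0 := by
      by_contra! H
      apply hν
      rw [← pull_id E (pull E A g ν), ← biproduct.total, hE.pull_sum, LinearMap.sum_apply]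
      exact Finset.sum_eq_zero fun j _ => by rw [pull_comp, H, map_zero]
    obtain ⟨j, hj⟩ := hι
    obtain ⟨θ, hθ⟩ := (hε j).exists_push A _ hj
    have h1 := hg (push E Y (θ ≫ S.inc j) ν)
    rw [hΦ, Finset.sum_eq_single j] at h1
    · rw [← pull_push, ← push_comp, Category.assoc, S.inc_proj_self, Category.comp_id, pull_push,
        pull_push, hθ] at h1
      exact hφ j h1
    · intro l _ hl
      rw [← pull_push, ← push_comp, Category.assoc, S.inc_proj_of_ne j l hl.symm, comp_zero,
        hE.push_zero, LinearMap.zero_apply, map_zero, map_zero, map_zero]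
    · simp

/-- A summand of the left end term of a distinguished `n`-exangle that begins with a radical
morphism and ends with a right determined morphism is the left end term of an almost split
`n`-exangle. -/
theorem exists_isAlmostSplit_summand [IsArtinianRing k] (hKS : IsKrullSchmidt C)
    (hE : IsBilinear E) (hfin : IsExtFinite E) (hs : IsNExangulated s) (hwic : SatisfiesWIC s)
    (hn : 1 ≤ n) {K Y T : C} {δ : ExtMod E Y K} {X : NComplex n K Y} (hX : Realizes s X δ)
    (hrad : IsRadical X.dFirst) (hT : IsRightDetermined X.dLast T) {m : ℕ}
    (S : LocalDecomposition m K) (j : Fin m) :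
    ∃ (Z : C) (ε : ExtMod E Z (S.summand j)), IsAlmostSplit ε := by
  have hx := hs.isNExangle _ _ hX
  rw [hx.isRightDetermined_dLast_iff] at hT
  -- The extension `μ` of this inflation is nonzero, as a radical `dFirst` does not split on a
  -- summand, and `(S.inc j)_* μ` is a multiple of `δ`. Since `S.inc j` splits, detection passes
  -- from the multiples of `δ` to those of `μ`.
  have hinf : IsInflation s (S.inc j ≫ X.dFirst) := hs.inflation_comp _ _
    (hwic.isInflation_of_comp_eq_id hs.toIsExactRealization hn (S.inc_proj_self j)) hX.isInflation
  obtain ⟨M, μ, hμ, hμ0, -⟩ := hinf.exists_extension hE hs hn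
  rw [push_comp] at hμ
  obtain ⟨g₀, hg₀⟩ := hs.exists_pull_eq hE hn hX _ hμ
  refine exists_isAlmostSplit hKS hE hfin hs hwic hn (T := T) (μ := μ) (fun h0 => ?_)
    fun L g hg => ?_
  · obtain ⟨r, hr⟩ := hμ0 h0
    exact hrad.comp_ne_one (S.inc j) r (by rw [← hr, Category.assoc])
  · have h1 : pull E K (g ≫ g₀) δ = push E L (S.inc j) (pull E _ g μ) := by
      rw [pull_comp, hg₀, pull_push]
    obtain ⟨h, hh⟩ := hT L (g ≫ g₀) fun h0 => hg (by
      rw [h1] at h0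
      have h2 := congrArg (push E L (S.proj j)) h0
      rwa [← push_comp, S.inc_proj_self, push_id, map_zero] at h2)
    refine ⟨h, fun h0 => hh ?_⟩
    rw [h1, pull_push, h0, map_zero]

theorem exists_isDeflation_of_memCl (hKS : IsKrullSchmidt C) (hn : 1 ≤ n) (hE : IsBilinear E)
    (hs : IsExactRealization s) {K : C} (hK : HasNoInjectiveSummands s K) (h : MemCl hE K) :
    ∃ (X Y : C) (α : X ⟶ Y), IsDeflation s α ∧ (∃ T : C, IsRightDetermined α T) ∧
      IsIntrinsicNKernel s α K := by
  obtain ⟨T, hT⟩ := h.exists_pull_ne_zero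
  obtain ⟨Y, δ, hδ⟩ := exists_extension_isRadical_dFirst hKS hE hs hK
  obtain ⟨X₀, hX₀⟩ := exists_realizes s δ
  -- Cancellation changes the complex, but `hδ` covers every realization of `δ`, so the first
  -- differential stays radical.
  obtain ⟨X, heq, hXrad⟩ := X₀.exists_homotopyEquivalent_isRadical hKS
  have hX := hX₀.of_homotopyEquivalent heq
  have hx := hs.isNExangle _ _ hX
  have hrad : ∀ i, i < n → IsRadical (X.cx.d i (i + 1)) := by
    intro i hi
    obtain rfl | hi0 := Nat.eq_zero_or_pos i
    · have h1 := (hδ X hX).comp_left X.left.hom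
      rwa [NComplex.dFirst, Iso.hom_inv_id_assoc] at h1
    · exact hXrad i hi0 hi
  obtain ⟨n, rfl⟩ : ∃ l, n = l + 1 := ⟨n - 1, by omega⟩
  exact ⟨_, Y, X.dLast, hX.isDeflation,
    ⟨T, hx.isRightDetermined_dLast_iff.2 fun L g hg => hT L _ hg⟩,
    δ, X, hX, ⟨hx.isRightMinimal_dLast (hrad n (Nat.lt_succ_self n)),
      ⟨𝟙 _, Category.id_comp _⟩, ⟨𝟙 _, Category.id_comp _⟩⟩, hrad⟩

theorem memCl_of_isIntrinsicNKernel [IsArtinianRing k] (hKS : IsKrullSchmidt C)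
    (hE : IsBilinear E) (hfin : IsExtFinite E) (hs : IsNExangulated s) (hwic : SatisfiesWIC s)
    (hn : 1 ≤ n) {B Y T K : C} {α : B ⟶ Y} (hα : IsRightDetermined α T)
    (hK : IsIntrinsicNKernel s α K) : MemCl hE K := by
  obtain ⟨δ, X, hX, ⟨-, heq⟩, hrad⟩ := hK
  obtain ⟨m, ⟨S⟩⟩ := LocalDecomposition.exists_of_isKrullSchmidt hKS K
  exact memCl_of_isAlmostSplit hE hfin S fun j =>
    exists_isAlmostSplit_summand hKS hE hfin hs hwic hn hX ((hrad 0 hn).comp_left _)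
      (isRightDetermined_of_rightEquivalent heq hα) S j

end Socle

end NExangulated

theorem proposition4p15
    {k : Type u'} [CommRing k] [IsArtinianRing k]
    {C : Type u} [Category.{v} C] [Preadditive C] [HasFiniteBiproducts C] [Linear k C]
    (hKS : IsKrullSchmidt C)
    (n : ℕ) (hn : 1 ≤ n)
    (E : Cᵒᵖ ⥤ C ⥤ ModuleCat.{w} k) (hE : IsBilinear E) (hfin : IsExtFinite E)
    (s : Correspondence E n) (hs : IsNExangulated s) (hwic : SatisfiesWIC s)
    (K : C) (hK : HasNoInjectiveSummands s K) :
    MemCl hE K ↔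
      ∃ (X Y : C) (α : X ⟶ Y), IsDeflation s α ∧ (∃ T : C, IsRightDetermined α T) ∧
        IsIntrinsicNKernel s α K := by
  constructor
  · exact exists_isDeflation_of_memCl hKS hn hE hs.toIsExactRealization hK
  · rintro ⟨X, Y, α, -, ⟨T, hT⟩, hα⟩
    exact memCl_of_isIntrinsicNKernel hKS hE hfin hs hwic hn hT hα
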